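/- For every $K>0$ there exist constants $C>0$ and $c\in(0,1)$, depending only on $K$, such that the following holds. Let $n\ge 1$ and let $X_1,\dots,X_n$ be random vectors in $\mathbb{R}^n$ on a common probability space, whose $n^2$ coordinates (all coordinates of all the vectors) are independent and identically distributed real random variables $\xi$ with zero mean and unit variance that are subgaussian with subgaussian moment $K$, i.e. $\mathbb{P}(|\xi|>t)\le 2e^{-t^2/K^2}$ for all $t>0$. Let $H_n=\operatorname{span}(X_1,\dots,X_{n-1})$ (so $H_1=\{0\}$). Then, with $\operatorname{dist}$ the Euclidean distance, $$\mathbb{P}\big(\operatorname{dist}(X_n,H_n)\le\varepsilon\big)\le C\varepsilon+c^n\qquad\text{for all }\varepsilon\ge 0.$$ -/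

import Mathlib

open MeasureTheory ProbabilityTheory

/-- `K > 0` is a subgaussian moment of the real random variable `ξ` on `(Ω, μ)`:
`ℙ(|ξ| > t) ≤ 2 exp(-t² / K²)` for every `t > 0`. -/
def HasSubgaussianMoment {Ω : Type*} [MeasurableSpace Ω] (μ : Measure Ω) (ξ : Ω → ℝ) (K : ℝ) :
    Prop :=
  0 < K ∧ ∀ t : ℝ, 0 < t → μ.real {ω | t < |ξ ω|} ≤ 2 * Real.exp (-t ^ 2 / K ^ 2)

/-- The linear span of the first `n - 1` of the vectors `x 0, …, x (n - 1)` in `ℝⁿ`. -/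
def spanInit {n : ℕ} (x : Fin n → EuclideanSpace ℝ (Fin n)) :
    Submodule ℝ (EuclideanSpace ℝ (Fin n)) :=
  Submodule.span ℝ {v | ∃ i : Fin n, (i : ℕ) + 1 < n ∧ x i = v}

/-!
The distance from a vector to a hyperplane is the length of its projection onto a unit normal `x`.
The normal of the span of the first `n - 1` vectors is independent of the last vector, so by Fubini
it suffices to bound the probability that a fixed linear form `S = ∑ xⱼ ξⱼ` is small, for every `x`
outside an exponentially unlikely set of normals.

*Small balls.* Smoothing with a Gaussian variable `g`, the expectation of `exp (-S² / (2 t²))` is at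
most the Gaussian average of `∏ |φ (g xⱼ / t)|`, where `φ` is the characteristic function of `ξ`
(`integral_exp_sq_le_integral_charFun`). The symmetrization of `ξ` lies in a fixed annulus with
probability bounded below (`SubgaussianLaw.window`), and there `1 - cos` controls the squared
distance to the integers. Hence, if `θ x` keeps distance at least `min (γ θ) α` from the lattice `ℤⁿ`
for all `0 < θ < D` (`FarFromLattice`), the average is `O(t / γ)` up to exponentially small errors as
long as `t D` is at least of order `α` (`SubgaussianLaw.small_ball`). This Laplace-transform form
of the estimate is multiplicative over independent rows.

*Normals.* A unit vector `x` in the kernel of the matrix `W` of the first `n - 1` vectors is far from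
the lattice up to an exponentially large `D` with high probability
(`exists_kernel_farFromLattice`). The norm of `W` is `O(√n)` (`SubgaussianLaw.opNorm_tail`). If `θ x`
is close to an integer point `p`, then `W p = W (p - θ x)` is small, and a union bound over `p`
applies. For `θ` below a small multiple of `√n` the number of possible `p` is a small exponential
(`card_latticeBall_le`), which is beaten by the crude estimate for a single vector
(`SubgaussianLaw.short_lattice`); no separate treatment of compressible vectors is needed. For `θ`
of order `2 ^ k √n`, with `x` far from the lattice at all lower levels, there are `O(2 ^ k) ^ n` points
`p`, and each is represented by a unit vector that is far from the lattice at the lower levels, for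
which the small ball estimate gives a probability `O(μ / 2 ^ k) ^ (n - 1)`
(`SubgaussianLaw.measure_levelSet`). Choosing the closeness parameter `μ` small makes the sum over
the levels `2 ^ k ≤ exp (q n)` exponentially small.

In bounded dimensions the fine estimate is vacuous, and the crude one, which bounds the probability
of a distance below `1 / 2` away from `1`, takes its place (`SubgaussianLaw.rowDist_crude`).
-/

open scoped Matrix

/-! ### Subgaussian tails and moments -/

/-- The absence of a constant term is what turns a vanishing mean into a Gaussian moment generating
function. -/
theorem exp_le_add_exp_sq (x : ℝ) : Real.exp x ≤ x + Real.exp (x ^ 2) := by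
  have h2 : x ^ 2 + 1 ≤ Real.exp (x ^ 2) := Real.add_one_le_exp _
  rcases le_or_gt |x| 1 with h | h
  · have h1 := (abs_le.1 (Real.abs_exp_sub_one_sub_id_le h)).2
    linarith
  · rcases lt_abs.1 h with h | h
    · have : Real.exp x ≤ Real.exp (x ^ 2) := Real.exp_le_exp.2 (by nlinarith)
      linarith
    · have : Real.exp x ≤ 1 := Real.exp_le_one_iff.2 (by linarith)
      nlinarith

theorem pow_four_le_exp {K x : ℝ} (hK : 0 < K) :
    x ^ 4 ≤ 8 * K ^ 4 * Real.exp (x ^ 2 / (2 * K ^ 2)) := by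
  have h := Real.quadratic_le_exp_of_nonneg (show 0 ≤ x ^ 2 / (2 * K ^ 2) by positivity)
  have h1 : x ^ 4 = 8 * K ^ 4 * ((x ^ 2 / (2 * K ^ 2)) ^ 2 / 2) := by field_simp; ring
  rw [h1]
  have : 0 ≤ x ^ 2 / (2 * K ^ 2) := by positivity
  gcongr
  linarith

theorem three_le_exp : (3 : ℝ) ≤ Real.exp (5 / 4) := by
  have := Real.quadratic_le_exp_of_nonneg (show (0 : ℝ) ≤ 5 / 4 by norm_num)
  norm_num at this ⊢
  linarith

/-- Subgaussian tails give a square-exponential moment, by the layer cake formula. -/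
theorem exp_sq_moment_of_tail {Ω : Type*} [MeasurableSpace Ω] {μ : Measure Ω}
    [IsProbabilityMeasure μ] {Y : Ω → ℝ} (hY : Measurable Y) {K : ℝ} (hK : 0 < K)
    (h : ∀ t : ℝ, 0 < t → μ.real {ω | t < |Y ω|} ≤ 2 * Real.exp (-t ^ 2 / K ^ 2)) :
    Integrable (fun ω => Real.exp (Y ω ^ 2 / (2 * K ^ 2))) μ ∧
      ∫ ω, Real.exp (Y ω ^ 2 / (2 * K ^ 2)) ∂μ ≤ 3 := by
  have hm : Measurable fun ω => Y ω ^ 2 / (2 * K ^ 2) := by fun_prop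
  have key := lintegral_comp_eq_lintegral_meas_lt_mul μ
    (f := fun ω => Y ω ^ 2 / (2 * K ^ 2)) (g := Real.exp)
    (Filter.Eventually.of_forall fun ω => by positivity) hm.aemeasurable
    (fun t _ => Real.continuous_exp.intervalIntegrable _ _)
    (Filter.Eventually.of_forall fun t => (Real.exp_pos t).le)
  simp only [integral_exp, Real.exp_zero] at key
  have hb : ∀ t ∈ Set.Ioi (0 : ℝ), μ {a | t < Y a ^ 2 / (2 * K ^ 2)} * ENNReal.ofReal (Real.exp t)
      ≤ ENNReal.ofReal (2 * Real.exp (-t)) := by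
    intro t ht
    have ht : 0 < t := ht
    have hs : {a | t < Y a ^ 2 / (2 * K ^ 2)} ⊆ {a | K * √(2 * t) < |Y a|} := by
      intro a ha
      simp only [Set.mem_ofPred_eq] at ha ⊢
      rw [lt_div_iff₀ (by positivity)] at ha
      apply lt_of_pow_lt_pow_left₀ 2 (abs_nonneg _)
      rw [sq_abs, mul_pow, Real.sq_sqrt (by positivity)]
      linarith
    have h1 := h (K * √(2 * t)) (by positivity)
    have h2 : μ {a | t < Y a ^ 2 / (2 * K ^ 2)} ≤ ENNReal.ofReal (2 * Real.exp (-(2 * t))) := by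
      refine (measure_mono hs).trans ?_
      rw [← ofReal_measureReal]
      apply ENNReal.ofReal_le_ofReal
      refine h1.trans (le_of_eq ?_)
      rw [mul_pow, Real.sq_sqrt (by positivity)]
      congr 2
      field_simp
    refine (mul_le_mul_left h2 _).trans ?_
    rw [← ENNReal.ofReal_mul (by positivity), mul_assoc, ← Real.exp_add]
    apply le_of_eq; congr 3; ring
  have h3 : ∫⁻ ω, ENNReal.ofReal (Real.exp (Y ω ^ 2 / (2 * K ^ 2)) - 1) ∂μ ≤ ENNReal.ofReal 2 := by
    rw [key]
    refine (setLIntegral_mono (by fun_prop) hb).trans ?_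
    rw [← ofReal_integral_eq_lintegral_ofReal]
    · apply ENNReal.ofReal_le_ofReal
      rw [integral_const_mul, integral_exp_neg_Ioi_zero]
      simp
    · exact (integrableOn_exp_neg_Ioi 0).const_mul 2
    · exact Filter.Eventually.of_forall fun t => by positivity
  have hnn : ∀ ω, 0 ≤ Real.exp (Y ω ^ 2 / (2 * K ^ 2)) - 1 := fun ω => by
    have := Real.one_le_exp (show 0 ≤ Y ω ^ 2 / (2 * K ^ 2) by positivity)
    linarith
  have hint : Integrable (fun ω => Real.exp (Y ω ^ 2 / (2 * K ^ 2)) - 1) μ := by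
    refine ⟨by fun_prop, ?_⟩
    rw [hasFiniteIntegral_iff_ofReal (Filter.Eventually.of_forall hnn)]
    exact h3.trans_lt ENNReal.ofReal_lt_top
  have hint' : Integrable (fun ω => Real.exp (Y ω ^ 2 / (2 * K ^ 2))) μ := by
    refine (hint.add (integrable_const (1 : ℝ))).congr (Filter.Eventually.of_forall fun ω => ?_)
    simp
  refine ⟨hint', ?_⟩
  have h4 : ∫ ω, (Real.exp (Y ω ^ 2 / (2 * K ^ 2)) - 1) ∂μ ≤ 2 := by
    rw [integral_eq_lintegral_of_nonneg_ae (Filter.Eventually.of_forall hnn) hint.1]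
    exact ENNReal.toReal_le_of_le_ofReal (by norm_num) h3
  rw [integral_sub hint' (integrable_const _)] at h4
  simp at h4
  linarith

theorem fourth_moment_of_tail {Ω : Type*} [MeasurableSpace Ω] {μ : Measure Ω}
    [IsProbabilityMeasure μ] {Y : Ω → ℝ} (hY : Measurable Y) {K : ℝ} (hK : 0 < K)
    (h : ∀ t : ℝ, 0 < t → μ.real {ω | t < |Y ω|} ≤ 2 * Real.exp (-t ^ 2 / K ^ 2)) :
    Integrable (fun ω => Y ω ^ 4) μ ∧ ∫ ω, Y ω ^ 4 ∂μ ≤ 24 * K ^ 4 := by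
  obtain ⟨h1, h2⟩ := exp_sq_moment_of_tail hY hK h
  have h3 : Integrable (fun ω => Y ω ^ 4) μ := by
    refine (h1.const_mul (8 * K ^ 4)).mono' (by fun_prop) (Filter.Eventually.of_forall fun ω => ?_)
    rw [Real.norm_of_nonneg (by positivity)]
    exact pow_four_le_exp hK
  refine ⟨h3, (integral_mono h3 (h1.const_mul (8 * K ^ 4)) fun ω => pow_four_le_exp hK).trans ?_⟩
  rw [integral_const_mul]
  have : 0 < K ^ 4 := by positivity
  nlinarith

/-- A centred variable with subgaussian tails has a Gaussian moment generating function. For small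
arguments this is the square-exponential moment raised to a power at most one, for large ones
Young's inequality. -/
theorem hasSubgaussianMGF_of_tail {Ω : Type*} [MeasurableSpace Ω] {μ : Measure Ω}
    [IsProbabilityMeasure μ] {Y : Ω → ℝ} (hY : Measurable Y) {K : ℝ} (hK : 0 < K)
    (h : ∀ t : ℝ, 0 < t → μ.real {ω | t < |Y ω|} ≤ 2 * Real.exp (-t ^ 2 / K ^ 2))
    (h0 : ∫ ω, Y ω ∂μ = 0) :
    HasSubgaussianMGF Y (Real.toNNReal (6 * K ^ 2)) μ := by
  obtain ⟨h1, h2⟩ := exp_sq_moment_of_tail hY hK h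
  have young : ∀ l ω, l * Y ω ≤ l ^ 2 * K ^ 2 / 2 + Y ω ^ 2 / (2 * K ^ 2) := by
    intro l ω
    have : l ^ 2 * K ^ 2 / 2 + Y ω ^ 2 / (2 * K ^ 2) - l * Y ω = (l * K - Y ω / K) ^ 2 / 2 := by
      field_simp; ring
    nlinarith [sq_nonneg (l * K - Y ω / K)]
  have hint : ∀ l, Integrable (fun ω => Real.exp (l * Y ω)) μ := by
    intro l
    refine (h1.const_mul (Real.exp (l ^ 2 * K ^ 2 / 2))).mono' (by fun_prop)
      (Filter.Eventually.of_forall fun ω => ?_)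
    rw [Real.norm_of_nonneg (by positivity), ← Real.exp_add]
    exact Real.exp_le_exp.2 (young l ω)
  have hYi : Integrable Y μ := by
    have : Integrable (fun ω => Real.exp (Y ω) + Real.exp (-Y ω)) μ := by
      refine ((hint 1).add (hint (-1))).congr (Filter.Eventually.of_forall fun ω => ?_)
      simp
    refine this.mono' (by fun_prop) (Filter.Eventually.of_forall fun ω => ?_)
    rw [Real.norm_eq_abs, abs_le]
    have a := Real.add_one_le_exp (Y ω)
    have b := Real.add_one_le_exp (-Y ω)
    have a' := Real.exp_pos (Y ω)
    have b' := Real.exp_pos (-Y ω)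
    constructor <;> linarith
  refine ⟨hint, fun l => ?_⟩
  rw [Real.coe_toNNReal _ (by positivity), mgf]
  have h3 := three_le_exp
  rcases le_or_gt (2 * K ^ 2 * l ^ 2) 1 with hl | hl
  · set p := 2 * K ^ 2 * l ^ 2 with hp
    have hp0 : 0 ≤ p := by positivity
    have e1 : ∀ ω, Real.exp ((l * Y ω) ^ 2) = Real.exp (Y ω ^ 2 / (2 * K ^ 2)) ^ p := by
      intro ω
      rw [← Real.exp_mul]; congr 1; rw [hp]; field_simp
    -- concavity of `y ↦ y ^ p` in the form of the weighted AM-GM inequality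
    have e2 : ∀ ω, Real.exp ((l * Y ω) ^ 2) ≤
        3 ^ p * (p * (Real.exp (Y ω ^ 2 / (2 * K ^ 2)) / 3) + (1 - p)) := by
      intro ω
      rw [e1]
      have := Real.geom_mean_le_arith_mean2_weighted (w₁ := p) (w₂ := 1 - p)
        (p₁ := Real.exp (Y ω ^ 2 / (2 * K ^ 2)) / 3) (p₂ := 1) hp0 (by linarith) (by positivity)
        (by norm_num) (by ring)
      rw [Real.one_rpow, mul_one, mul_one, Real.div_rpow (by positivity) (by norm_num)] at this
      rwa [div_le_iff₀ (by positivity), mul_comm _ ((3 : ℝ) ^ p)] at this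
    have i2 : Integrable (fun ω => 3 ^ p * (p * (Real.exp (Y ω ^ 2 / (2 * K ^ 2)) / 3) + (1 - p))) μ :=
      ((((h1.div_const 3).const_mul p).add (integrable_const _)).const_mul _)
    calc ∫ ω, Real.exp (l * Y ω) ∂μ
        ≤ ∫ ω, (l * Y ω + 3 ^ p * (p * (Real.exp (Y ω ^ 2 / (2 * K ^ 2)) / 3) + (1 - p))) ∂μ := by
          refine integral_mono (hint l) ((hYi.const_mul l).add i2) fun ω => ?_
          exact (exp_le_add_exp_sq _).trans (by simpa using e2 ω)
      _ = 3 ^ p * (p * ((∫ ω, Real.exp (Y ω ^ 2 / (2 * K ^ 2)) ∂μ) / 3) + (1 - p)) := by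
          rw [integral_add (hYi.const_mul l) i2, integral_const_mul, h0, integral_const_mul,
            integral_add ((h1.div_const 3).const_mul p) (integrable_const _), integral_const_mul,
            integral_div]
          simp
      _ ≤ 3 ^ p * 1 := by
          gcongr
          nlinarith
      _ ≤ Real.exp (5 / 4) ^ p := by rw [mul_one]; gcongr
      _ ≤ _ := by
          rw [← Real.exp_mul]
          apply Real.exp_le_exp.2
          rw [hp]
          nlinarith [sq_nonneg (K * l)]
  · calc ∫ ω, Real.exp (l * Y ω) ∂μ
        ≤ ∫ ω, Real.exp (l ^ 2 * K ^ 2 / 2) * Real.exp (Y ω ^ 2 / (2 * K ^ 2)) ∂μ := by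
          refine integral_mono (hint l) (h1.const_mul _) fun ω => ?_
          simp only
          rw [← Real.exp_add]
          exact Real.exp_le_exp.2 (young l ω)
      _ ≤ Real.exp (l ^ 2 * K ^ 2 / 2) * Real.exp (5 / 4) := by
          rw [integral_const_mul]; gcongr; exact h2.trans h3
      _ ≤ _ := by
          rw [← Real.exp_add]
          apply Real.exp_le_exp.2
          nlinarith [sq_nonneg (K * l)]

theorem ProbabilityTheory.HasSubgaussianMGF.tail {Ω : Type*} [MeasurableSpace Ω] {μ : Measure Ω}
    [IsProbabilityMeasure μ] {Y : Ω → ℝ} {c : NNReal} (h : HasSubgaussianMGF Y c μ) {t : ℝ}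
    (ht : 0 < t) : μ.real {ω | t < |Y ω|} ≤ 2 * Real.exp (-t ^ 2 / (2 * c)) := by
  have hs : {ω | t < |Y ω|} ⊆ {ω | t ≤ Y ω} ∪ {ω | t ≤ (-Y) ω} := by
    intro ω hω
    have hω : t < |Y ω| := hω
    rcases lt_abs.1 hω with h | h
    · exact Or.inl h.le
    · exact Or.inr h.le
  refine (measureReal_mono hs).trans ((measureReal_union_le _ _).trans ?_)
  rw [two_mul]
  exact add_le_add (h.measure_ge_le ht.le) (h.neg.measure_ge_le ht.le)

/-! ### Linear forms in independent subgaussian coordinates -/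

/-- The probability law `ν` on `ℝ` is centred, has unit variance, and has subgaussian tails with
moment `K`. -/
structure SubgaussianLaw (K : ℝ) (ν : Measure ℝ) : Prop where
  pos : 0 < K
  mean : ∫ x, x ∂ν = 0
  second : ∫ x, x ^ 2 ∂ν = 1
  tail : ∀ t : ℝ, 0 < t → ν.real {x | t < |x|} ≤ 2 * Real.exp (-t ^ 2 / K ^ 2)

section

variable {ι : Type*} [Fintype ι] {K : ℝ} {ν : Measure ℝ} [IsProbabilityMeasure ν]

theorem measurable_dotProduct_right (x : ι → ℝ) : Measurable fun y : ι → ℝ => y ⬝ᵥ x := by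
  unfold dotProduct; fun_prop

theorem SubgaussianLaw.memLp_two (h : SubgaussianLaw K ν) : MemLp (fun x : ℝ => x) 2 ν :=
  (hasSubgaussianMGF_of_tail measurable_id h.pos h.tail h.mean).memLp 2

theorem iIndepFun_const_mul_coord (ν : Measure ℝ) [IsProbabilityMeasure ν] (x : ι → ℝ) :
    iIndepFun (fun (j : ι) (y : ι → ℝ) => x j * y j) (Measure.pi fun _ : ι => ν) :=
  iIndepFun_pi (μ := fun _ => ν) (X := fun j (z : ℝ) => x j * z)
    fun j => (measurable_const_mul (x j)).aemeasurable

/-- A linear form with coefficients in the unit ball is again subgaussian. -/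
theorem SubgaussianLaw.dotProduct_tail (h : SubgaussianLaw K ν) {x : ι → ℝ}
    (hx : ∑ j, x j ^ 2 ≤ 1) {t : ℝ} (ht : 0 < t) :
    (Measure.pi fun _ : ι => ν).real {y | t < |y ⬝ᵥ x|} ≤ 2 * Real.exp (-t ^ 2 / (4 * K) ^ 2) := by
  have hK := h.pos
  have h1 : HasSubgaussianMGF (fun x : ℝ => x) (Real.toNNReal (6 * K ^ 2)) ν :=
    hasSubgaussianMGF_of_tail measurable_id h.pos h.tail h.mean
  have h2 : ∀ j : ι, HasSubgaussianMGF (fun y : ι → ℝ => y j) (Real.toNNReal (6 * K ^ 2))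
      (Measure.pi fun _ : ι => ν) := by
    intro j
    have hmp := measurePreserving_eval (fun _ : ι => ν) j
    have := HasSubgaussianMGF.of_map (μ := Measure.pi fun _ : ι => ν) (Y := fun y : ι → ℝ => y j)
      (X := fun x : ℝ => x) (c := Real.toNNReal (6 * K ^ 2)) (measurable_pi_apply j).aemeasurable
      (by rw [hmp.map_eq]; exact h1)
    exact this
  obtain ⟨c, hc, h3⟩ : ∃ c : NNReal, (c : ℝ) = (∑ j, x j ^ 2) * (6 * K ^ 2) ∧
      HasSubgaussianMGF (fun y : ι → ℝ => ∑ j, x j * y j) c (Measure.pi fun _ : ι => ν) := by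
    refine ⟨_, ?_, HasSubgaussianMGF.sum_of_iIndepFun (iIndepFun_const_mul_coord ν x)
      (s := Finset.univ) fun j _ => (h2 j).const_mul (x j)⟩
    rw [NNReal.coe_sum, Finset.sum_mul]
    refine Finset.sum_congr rfl fun j _ => ?_
    exact (NNReal.coe_mul (NNReal.mk (x j ^ 2) (sq_nonneg _)) _).trans
      (congrArg (x j ^ 2 * ·) (Real.coe_toNNReal _ (by positivity)))
  have h4 := h3.tail ht
  have e1 : ∀ y : ι → ℝ, ∑ j, x j * y j = y ⬝ᵥ x := fun y => by
    simp [dotProduct, mul_comm]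
  simp only [e1] at h4
  by_cases hx0 : ∑ j, x j ^ 2 = 0
  · have : x = 0 := by
      ext j
      have := (Finset.sum_eq_zero_iff_of_nonneg (fun j _ => sq_nonneg (x j))).1 hx0 j (by simp)
      simpa using this
    subst this
    simp only [dotProduct_zero, abs_zero, not_lt.2 ht.le]
    simp
    positivity
  refine h4.trans ?_
  have hpos : 0 < ∑ j, x j ^ 2 := lt_of_le_of_ne (Finset.sum_nonneg fun j _ => sq_nonneg _)
    (Ne.symm hx0)
  gcongr 2 * ?_
  apply Real.exp_le_exp.2
  have hK2 : 0 < K ^ 2 := by positivity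
  rw [hc, neg_div, neg_div, neg_le_neg_iff]
  exact div_le_div_of_nonneg_left (by positivity) (by positivity) (by nlinarith)

theorem SubgaussianLaw.exp_sq_moment (h : SubgaussianLaw K ν) {x : ι → ℝ}
    (hx : ∑ j, x j ^ 2 ≤ 1) :
    Integrable (fun y => Real.exp ((y ⬝ᵥ x) ^ 2 / (32 * K ^ 2))) (Measure.pi fun _ : ι => ν) ∧
      ∫ y, Real.exp ((y ⬝ᵥ x) ^ 2 / (32 * K ^ 2)) ∂(Measure.pi fun _ : ι => ν) ≤ 3 := by
  have hK := h.pos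
  have := exp_sq_moment_of_tail (measurable_dotProduct_right x) (by positivity)
    fun t ht => h.dotProduct_tail hx ht
  have e : 2 * (4 * K) ^ 2 = 32 * K ^ 2 := by ring
  simpa only [e] using this

theorem SubgaussianLaw.dotProduct_second (h : SubgaussianLaw K ν) {x : ι → ℝ}
    (hx : ∑ j, x j ^ 2 = 1) : ∫ y, (y ⬝ᵥ x) ^ 2 ∂(Measure.pi fun _ : ι => ν) = 1 := by
  have hL : ∀ j : ι, MemLp (fun y : ι → ℝ => x j * y j) 2 (Measure.pi fun _ : ι => ν) := fun j =>
    ((h.memLp_two.comp_measurePreserving (measurePreserving_eval (fun _ : ι => ν) j))).const_mul _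
  have hmean : ∀ j : ι, ∫ y : ι → ℝ, x j * y j ∂(Measure.pi fun _ : ι => ν) = 0 := by
    intro j
    rw [integral_const_mul, integral_comp_eval (μ := fun _ : ι => ν) (f := fun z : ℝ => z)
      aestronglyMeasurable_id, h.mean, mul_zero]
  have hvar : ∀ j : ι, variance (fun y : ι → ℝ => x j * y j) (Measure.pi fun _ : ι => ν)
      = x j ^ 2 := by
    intro j
    rw [variance_of_integral_eq_zero (hL j).aemeasurable (hmean j)]
    simp only [mul_pow]
    rw [integral_const_mul, integral_comp_eval (μ := fun _ : ι => ν) (f := fun z : ℝ => z ^ 2)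
      (by fun_prop), h.second, mul_one]
  have hS := IndepFun.variance_sum (s := Finset.univ) (fun j _ => hL j)
    (fun i _ j _ hij => (iIndepFun_const_mul_coord ν x).indepFun hij)
  have e1 : (∑ j, fun y : ι → ℝ => x j * y j) = fun y => y ⬝ᵥ x := by
    ext y; simp [dotProduct, mul_comm]
  rw [e1] at hS
  rw [variance_of_integral_eq_zero (measurable_dotProduct_right x).aemeasurable] at hS
  · rw [hS]; simp only [hvar]; exact hx
  · simp only [← congrFun e1, Finset.sum_apply]
    rw [integral_finsetSum _ fun j _ => (hL j).integrable one_le_two]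
    simp [hmean]

theorem Real.exp_neg_le_quadratic {u : ℝ} (hu : 0 ≤ u) : Real.exp (-u) ≤ 1 - u + u ^ 2 / 2 := by
  have h1 := Real.quadratic_le_exp_of_nonneg hu
  rw [Real.exp_neg, inv_le_iff_one_le_mul₀ (Real.exp_pos u)]
  have hpos : 0 < 1 - u + u ^ 2 / 2 := by nlinarith [sq_nonneg (u - 1)]
  calc (1 : ℝ) ≤ (1 - u + u ^ 2 / 2) * (1 + u + u ^ 2 / 2) := by nlinarith [sq_nonneg (u ^ 2)]
    _ ≤ _ := by gcongr

/-- Anti-concentration at constant scale: since the second moment is `1` and the fourth is bounded,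
the quadratic Taylor bound for `exp` keeps the Laplace transform of the square away from `1`. -/
theorem SubgaussianLaw.crude_laplace (h : SubgaussianLaw K ν) {x : ι → ℝ}
    (hx : ∑ j, x j ^ 2 = 1) {l : ℝ} (hl : l = 1 / (6144 * K ^ 4)) :
    ∫ y, Real.exp (-l * (y ⬝ᵥ x) ^ 2) ∂(Measure.pi fun _ : ι => ν) ≤ 1 - l / 2 := by
  have hK := h.pos
  have hl0 : 0 < l := by rw [hl]; positivity
  obtain ⟨h4, h4'⟩ := fourth_moment_of_tail (measurable_dotProduct_right x) (by positivity)
    fun t ht => h.dotProduct_tail hx.le ht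
  have h2 := h.dotProduct_second hx
  have h2' : Integrable (fun y : ι → ℝ => (y ⬝ᵥ x) ^ 2) (Measure.pi fun _ : ι => ν) := by
    by_contra hc
    rw [integral_undef hc] at h2
    norm_num at h2
  have hm := measurable_dotProduct_right x
  have hi : Integrable (fun y : ι → ℝ => Real.exp (-l * (y ⬝ᵥ x) ^ 2))
      (Measure.pi fun _ : ι => ν) := by
    refine (integrable_const (1 : ℝ)).mono' (by fun_prop) (Filter.Eventually.of_forall fun y => ?_)
    rw [Real.norm_of_nonneg (by positivity)]
    exact Real.exp_le_one_iff.2 (by nlinarith [sq_nonneg (y ⬝ᵥ x)])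
  calc _ ≤ ∫ y, (1 - l * (y ⬝ᵥ x) ^ 2 + l ^ 2 / 2 * (y ⬝ᵥ x) ^ 4) ∂(Measure.pi fun _ : ι => ν) := by
        refine integral_mono hi (((integrable_const _).sub (h2'.const_mul l)).add
          (h4.const_mul _)) fun y => ?_
        have := Real.exp_neg_le_quadratic (u := l * (y ⬝ᵥ x) ^ 2) (by positivity)
        simp only [neg_mul]
        refine this.trans (le_of_eq ?_)
        ring
    _ = 1 - l + l ^ 2 / 2 * ∫ y, (y ⬝ᵥ x) ^ 4 ∂(Measure.pi fun _ : ι => ν) := by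
        have i1 : Integrable (fun y : ι → ℝ => 1 - l * (y ⬝ᵥ x) ^ 2) (Measure.pi fun _ : ι => ν) :=
          (integrable_const _).sub (h2'.const_mul l)
        rw [integral_add i1 (h4.const_mul _),
          integral_sub (integrable_const _) (h2'.const_mul l), integral_const_mul,
          integral_const_mul, h2]
        simp
    _ ≤ 1 - l + l ^ 2 / 2 * (24 * (4 * K) ^ 4) := by gcongr
    _ = 1 - l / 2 := by
        have : l * (6144 * K ^ 4) = 1 := by rw [hl]; field_simp
        have e : l ^ 2 / 2 * (24 * (4 * K) ^ 4) = l / 2 * (l * (6144 * K ^ 4)) := by ring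
        rw [e, this]; ring

end

/-! ### Small ball probabilities and distances to the integer lattice -/

/-- Characteristic functions see the distance to the nearest integer. -/
theorem eight_mul_sq_sub_round_le (u : ℝ) :
    8 * (u - round u) ^ 2 ≤ 1 - Real.cos (2 * Real.pi * u) := by
  have h1 : |u - round u| ≤ 1 / 2 := abs_sub_round u
  have h2 : Real.cos (2 * Real.pi * u) = Real.cos (2 * Real.pi * (u - round u)) := by
    rw [← Real.cos_sub_int_mul_two_pi _ (round u)]; congr 1; ring
  have hpi := Real.pi_pos
  have h3 : |2 * Real.pi * (u - round u)| ≤ Real.pi := by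
    rw [abs_mul, abs_of_pos (by positivity)]
    nlinarith
  have h4 := Real.cos_le_one_sub_mul_cos_sq h3
  rw [h2]
  have e : 2 / Real.pi ^ 2 * (2 * Real.pi * (u - round u)) ^ 2 = 8 * (u - round u) ^ 2 := by
    field_simp; ring
  linarith

/-- The line through `x` stays away from the integer lattice up to the parameter `D`: every `θ • x`
with `0 < θ < D` has Euclidean distance at least `min (γ θ) α` to the lattice, that is, the least
common denominator of `x` with parameters `γ`, `α` is at least `D`. Distances are squared. -/
def FarFromLattice {ι : Type*} [Fintype ι] (γ α D : ℝ) (x : ι → ℝ) : Prop :=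
  ∀ θ : ℝ, 0 < θ → θ < D → min ((γ * θ) ^ 2) (α ^ 2) ≤ ∑ j, (θ * x j - round (θ * x j)) ^ 2

theorem integral_exp_neg_mul_sq_gaussianReal {c : ℝ} (hc : 0 < 1 + 2 * c) :
    Integrable (fun g : ℝ => Real.exp (-c * g ^ 2)) (gaussianReal 0 1) ∧
    ∫ g, Real.exp (-c * g ^ 2) ∂(gaussianReal 0 1) = (√(1 + 2 * c))⁻¹ := by
  have e : ∀ g : ℝ, gaussianPDFReal 0 1 g * Real.exp (-c * g ^ 2)
      = (√(2 * Real.pi))⁻¹ * Real.exp (-(c + 1 / 2) * g ^ 2) := by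
    intro g
    rw [gaussianPDFReal_def]
    simp only [NNReal.coe_one, mul_one, sub_zero]
    rw [mul_assoc, ← Real.exp_add]; congr 2; ring
  have hI : ∫ g, Real.exp (-c * g ^ 2) ∂(gaussianReal 0 1) = (√(1 + 2 * c))⁻¹ := by
    rw [integral_gaussianReal_eq_integral_smul one_ne_zero]
    simp only [smul_eq_mul, e]
    rw [integral_const_mul, integral_gaussian, ← Real.sqrt_inv, ← Real.sqrt_inv,
      ← Real.sqrt_mul (by positivity)]
    congr 1
    have := Real.pi_pos
    have h1 : c + 1 / 2 ≠ 0 := by linarith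
    have h2 : 1 + 2 * c ≠ 0 := hc.ne'
    have h3 : c + 1 / 2 = (1 + 2 * c) / 2 := by ring
    rw [h3]
    field_simp
  refine ⟨?_, hI⟩
  by_contra h
  rw [integral_undef h] at hI
  have : 0 < (√(1 + 2 * c))⁻¹ := by positivity
  linarith

section

variable {ι : Type*} [Fintype ι] {K : ℝ} {ν : Measure ℝ} [IsProbabilityMeasure ν]

theorem norm_charFun_sq (ν : Measure ℝ) [IsProbabilityMeasure ν] (s : ℝ) :
    ‖charFun ν s‖ ^ 2 = ∫ z : ℝ × ℝ, Real.cos (s * (z.1 - z.2)) ∂(ν.prod ν) := by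
  have hb : ∀ f : ℝ → ℝ, Measurable f → (∀ x, |f x| ≤ 1) → Integrable f ν := fun f hf h =>
    (integrable_const (1 : ℝ)).mono' hf.aestronglyMeasurable (Filter.Eventually.of_forall h)
  have hc := hb (fun x => Real.cos (s * x)) (by fun_prop) fun x => Real.abs_cos_le_one _
  have hs := hb (fun x => Real.sin (s * x)) (by fun_prop) fun x => Real.abs_sin_le_one _
  have h1 : charFun ν s = (∫ x, Real.cos (s * x) ∂ν : ℝ) + (∫ x, Real.sin (s * x) ∂ν : ℝ) * Complex.I := by
    rw [charFun_apply_real, ← integral_complex_ofReal, ← integral_complex_ofReal,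
      ← integral_mul_const, ← integral_add]
    · refine integral_congr_ae (Filter.Eventually.of_forall fun x => ?_)
      simp only
      rw [← Complex.ofReal_mul, Complex.exp_mul_I, Complex.ofReal_cos, Complex.ofReal_sin]
    · exact hc.ofReal
    · exact hs.ofReal.mul_const _
  rw [h1, ← Complex.normSq_eq_norm_sq, Complex.normSq_add_mul_I]
  simp only [mul_sub, Real.cos_sub]
  rw [integral_add (hc.mul_prod hc) (hs.mul_prod hs),
    integral_prod_mul (fun x => Real.cos (s * x)) (fun x => Real.cos (s * x)),
    integral_prod_mul (fun x => Real.sin (s * x)) (fun x => Real.sin (s * x))]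
  ring

/-- From `‖φ‖² ≤ exp (‖φ‖² - 1)`, where `‖φ‖²` is the characteristic function of the symmetrized
variable. -/
theorem norm_charFun_le_exp (ν : Measure ℝ) [IsProbabilityMeasure ν] (s : ℝ) :
    ‖charFun ν s‖ ≤ Real.exp (-∫ z : ℝ × ℝ, (1 - Real.cos (s * (z.1 - z.2))) / 2 ∂(ν.prod ν)) := by
  have hi : Integrable (fun z : ℝ × ℝ => Real.cos (s * (z.1 - z.2))) (ν.prod ν) :=
    (integrable_const (1 : ℝ)).mono' (by fun_prop)
      (Filter.Eventually.of_forall fun z => Real.abs_cos_le_one _)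
  rw [integral_div, integral_sub (integrable_const _) hi, ← norm_charFun_sq]
  refine le_of_pow_le_pow_left₀ two_ne_zero (Real.exp_pos _).le ?_
  rw [← Real.exp_nat_mul]
  have := Real.add_one_le_exp (‖charFun ν s‖ ^ 2 - 1)
  refine le_trans (by linarith) (this.trans (Real.exp_le_exp.2 (le_of_eq ?_)))
  simp
  ring

theorem integral_cexp_dotProduct (ν : Measure ℝ) [IsProbabilityMeasure ν] (x : ι → ℝ) (u : ℝ) :
    ∫ y, Complex.exp (((y ⬝ᵥ x : ℝ) : ℂ) * u * Complex.I) ∂(Measure.pi fun _ : ι => ν)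
      = ∏ j, charFun ν (u * x j) := by
  have e : ∀ y : ι → ℝ, Complex.exp (((y ⬝ᵥ x : ℝ) : ℂ) * u * Complex.I)
      = ∏ j, Complex.exp (((u * x j : ℝ) : ℂ) * y j * Complex.I) := by
    intro y
    rw [← Complex.exp_sum, dotProduct]
    push_cast
    rw [Finset.sum_mul, Finset.sum_mul]
    congr 1
    exact Finset.sum_congr rfl fun j _ => by ring
  simp only [e, charFun_apply_real]
  exact integral_fintype_prod_eq_prod (μ := fun _ : ι => ν)
    (fun j (z : ℝ) => Complex.exp (((u * x j : ℝ) : ℂ) * z * Complex.I))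

/-- Esseen's inequality with Gaussian smoothing: `exp (-s² / 2)` is the Gaussian average of
`exp (i g s)`, and the two averages are exchanged. -/
theorem integral_exp_sq_le_integral_charFun (ν : Measure ℝ) [IsProbabilityMeasure ν] (x : ι → ℝ)
    (t : ℝ) :
    ∫ y, Real.exp (-(y ⬝ᵥ x) ^ 2 / (2 * t ^ 2)) ∂(Measure.pi fun _ : ι => ν)
      ≤ ∫ g, ∏ j, ‖charFun ν (g / t * x j)‖ ∂(gaussianReal 0 1) := by
  have h1 : ∀ y : ι → ℝ, ((Real.exp (-(y ⬝ᵥ x) ^ 2 / (2 * t ^ 2)) : ℝ) : ℂ)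
      = ∫ g, Complex.exp (((y ⬝ᵥ x : ℝ) : ℂ) * ((g / t : ℝ) : ℂ) * Complex.I)
          ∂(gaussianReal 0 1) := by
    intro y
    have := charFun_gaussianReal (μ := 0) (v := 1) ((y ⬝ᵥ x) / t)
    rw [charFun_apply_real] at this
    have e : ∀ g : ℝ, ((y ⬝ᵥ x : ℝ) : ℂ) * ((g / t : ℝ) : ℂ) * Complex.I
        = (((y ⬝ᵥ x) / t : ℝ) : ℂ) * g * Complex.I := by intro g; push_cast; ring
    simp only [e]
    rw [this]
    push_cast
    congr 1
    simp
    ring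
  have h2 : ((∫ y, Real.exp (-(y ⬝ᵥ x) ^ 2 / (2 * t ^ 2)) ∂(Measure.pi fun _ : ι => ν) : ℝ) : ℂ)
      = ∫ g, ∏ j, charFun ν (g / t * x j) ∂(gaussianReal 0 1) := by
    rw [← integral_complex_ofReal]
    simp only [h1]
    rw [integral_integral_swap]
    · exact integral_congr_ae (Filter.Eventually.of_forall fun g =>
        integral_cexp_dotProduct ν x (g / t))
    · refine (integrable_const (1 : ℝ)).mono' ?_ (Filter.Eventually.of_forall fun z => ?_)
      · have : Measurable fun z : (ι → ℝ) × ℝ => z.1 ⬝ᵥ x :=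
          (measurable_dotProduct_right x).comp measurable_fst
        have hm : Measurable fun z : (ι → ℝ) × ℝ =>
            Complex.exp (((z.1 ⬝ᵥ x * (z.2 / t) : ℝ) : ℂ) * Complex.I) := by
          refine Complex.measurable_exp.comp ((Complex.measurable_ofReal.comp ?_).mul_const _)
          exact this.mul (measurable_snd.div_const t)
        refine (hm.aestronglyMeasurable).congr (Filter.Eventually.of_forall fun z => ?_)
        simp [Function.uncurry]
      · simp only [Function.uncurry]
        rw [← Complex.ofReal_mul, Complex.norm_exp_ofReal_mul_I]
  have h3 : 0 ≤ ∫ y, Real.exp (-(y ⬝ᵥ x) ^ 2 / (2 * t ^ 2)) ∂(Measure.pi fun _ : ι => ν) :=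
    integral_nonneg fun y => (Real.exp_pos _).le
  have h4 := congrArg norm h2
  rw [Complex.norm_real, Real.norm_of_nonneg h3] at h4
  rw [h4]
  refine (norm_integral_le_integral_norm _).trans (le_of_eq ?_)
  simp only [norm_prod]

/-- The symmetrized variable lies in a fixed annulus with probability bounded below. -/
theorem SubgaussianLaw.window (h : SubgaussianLaw K ν) :
    1 / (2 * (28 * K ^ 2) ^ 2) ≤
      (ν.prod ν).real {z | 1 ≤ |z.1 - z.2| ∧ |z.1 - z.2| ≤ 28 * K ^ 2} := by
  have hK := h.pos
  set b := 28 * K ^ 2 with hb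
  have hb0 : 0 < b := by positivity
  set W : Set (ℝ × ℝ) := {z | 1 ≤ |z.1 - z.2| ∧ |z.1 - z.2| ≤ b} with hW
  have hWm : MeasurableSet W := by
    have : Measurable fun z : ℝ × ℝ => |z.1 - z.2| := by fun_prop
    exact (measurableSet_le measurable_const this).inter (measurableSet_le this measurable_const)
  obtain ⟨h4, h4'⟩ := fourth_moment_of_tail measurable_id hK h.tail
  simp only [id] at h4 h4'
  have h2 : Integrable (fun x : ℝ => x ^ 2) ν := h.memLp_two.integrable_sq
  have h1 : Integrable (fun x : ℝ => x) ν := h.memLp_two.integrable one_le_two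
  have i1 : Integrable (fun z : ℝ × ℝ => z.1 ^ 2) (ν.prod ν) := h2.comp_fst ν
  have i2 : Integrable (fun z : ℝ × ℝ => z.2 ^ 2) (ν.prod ν) := h2.comp_snd ν
  have i3 : Integrable (fun z : ℝ × ℝ => z.1 * z.2) (ν.prod ν) := h1.mul_prod h1
  have i4 : Integrable (fun z : ℝ × ℝ => z.1 ^ 4) (ν.prod ν) := h4.comp_fst ν
  have i5 : Integrable (fun z : ℝ × ℝ => z.2 ^ 4) (ν.prod ν) := h4.comp_snd ν
  have v1 : ∫ z : ℝ × ℝ, z.1 ^ 2 ∂(ν.prod ν) = 1 := by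
    rw [integral_fun_fst (μ := ν) (ν := ν) (fun x : ℝ => x ^ 2)]; simp [h.second]
  have v2 : ∫ z : ℝ × ℝ, z.2 ^ 2 ∂(ν.prod ν) = 1 := by
    rw [integral_fun_snd (μ := ν) (ν := ν) (fun x : ℝ => x ^ 2)]; simp [h.second]
  have v3 : ∫ z : ℝ × ℝ, z.1 * z.2 ∂(ν.prod ν) = 0 := by
    rw [integral_prod_mul (fun x : ℝ => x) (fun x : ℝ => x), h.mean]; simp
  have v4 : ∫ z : ℝ × ℝ, z.1 ^ 4 ∂(ν.prod ν) ≤ 24 * K ^ 4 := by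
    rw [integral_fun_fst (μ := ν) (ν := ν) (fun x : ℝ => x ^ 4)]; simpa using h4'
  have v5 : ∫ z : ℝ × ℝ, z.2 ^ 4 ∂(ν.prod ν) ≤ 24 * K ^ 4 := by
    rw [integral_fun_snd (μ := ν) (ν := ν) (fun x : ℝ => x ^ 4)]; simpa using h4'
  have iW : Integrable (W.indicator fun _ => b ^ 2) (ν.prod ν) :=
    (integrable_const (b ^ 2)).indicator hWm
  -- small values of `(z.1 - z.2) ^ 2` cost at most `1`, large ones are paid by the fourth moment
  have pt : ∀ z : ℝ × ℝ, z.1 ^ 2 + z.2 ^ 2 - 2 * (z.1 * z.2) ≤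
      1 + 8 / b ^ 2 * (z.1 ^ 4 + z.2 ^ 4) + W.indicator (fun _ => b ^ 2) z := by
    intro z
    have e : z.1 ^ 2 + z.2 ^ 2 - 2 * (z.1 * z.2) = |z.1 - z.2| ^ 2 := by rw [sq_abs]; ring
    have e4 : |z.1 - z.2| ^ 4 ≤ 8 * (z.1 ^ 4 + z.2 ^ 4) := by
      have e5 : |z.1 - z.2| ^ 4 = (z.1 - z.2) ^ 4 := by
        rw [show 4 = 2 * 2 by norm_num, pow_mul, sq_abs, ← pow_mul]
      rw [e5]
      nlinarith [sq_nonneg (z.1 + z.2), sq_nonneg (z.1 ^ 2 - z.2 ^ 2), sq_nonneg (z.1 - z.2),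
        mul_nonneg (sq_nonneg (z.1 + z.2)) (sq_nonneg (z.1 + z.2)),
        mul_nonneg (sq_nonneg (z.1 - z.2)) (sq_nonneg (z.1 + z.2))]
    rw [e]
    have hnn : 0 ≤ 8 / b ^ 2 * (z.1 ^ 4 + z.2 ^ 4) := by positivity
    have a0 := abs_nonneg (z.1 - z.2)
    by_cases hz : z ∈ W
    · rw [Set.indicator_of_mem hz]
      have : |z.1 - z.2| ^ 2 ≤ b ^ 2 := by
        have := hz.2
        gcongr
      linarith
    · rw [Set.indicator_of_notMem hz]
      rcases lt_or_ge |z.1 - z.2| 1 with h | h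
      · have : |z.1 - z.2| ^ 2 ≤ 1 := pow_le_one₀ a0 h.le
        linarith
      · have hbz : b < |z.1 - z.2| := by
          by_contra hc
          exact hz ⟨h, not_lt.1 hc⟩
        have : |z.1 - z.2| ^ 2 ≤ 8 / b ^ 2 * (z.1 ^ 4 + z.2 ^ 4) := by
          rw [div_mul_eq_mul_div, le_div_iff₀ (by positivity)]
          refine le_trans ?_ e4
          have : b ^ 2 ≤ |z.1 - z.2| ^ 2 := by gcongr
          nlinarith [sq_nonneg |z.1 - z.2|]
        linarith
  have i12 : Integrable (fun z : ℝ × ℝ => z.1 ^ 2 + z.2 ^ 2) (ν.prod ν) := i1.add i2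
  have i45 : Integrable (fun z : ℝ × ℝ => z.1 ^ 4 + z.2 ^ 4) (ν.prod ν) := i4.add i5
  have i6 : Integrable (fun z : ℝ × ℝ => 1 + 8 / b ^ 2 * (z.1 ^ 4 + z.2 ^ 4)) (ν.prod ν) :=
    (integrable_const _).add (i45.const_mul _)
  have := integral_mono (i12.sub (i3.const_mul 2)) (i6.add iW) pt
  simp only [Pi.add_apply, Pi.sub_apply] at this
  rw [integral_sub i12 (i3.const_mul 2), integral_add i1 i2, integral_const_mul, v1, v2, v3,
    integral_add i6 iW, integral_add (integrable_const _) (i45.const_mul _), integral_const_mul,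
    integral_add i4 i5, integral_indicator_const _ hWm] at this
  simp only [integral_const, probReal_univ, smul_eq_mul, mul_one] at this
  have hb2 : 8 / b ^ 2 * ((∫ z : ℝ × ℝ, z.1 ^ 4 ∂(ν.prod ν)) + ∫ z : ℝ × ℝ, z.2 ^ 4 ∂(ν.prod ν))
      ≤ 1 / 2 := by
    rw [div_mul_eq_mul_div, div_le_iff₀ (by positivity)]
    have e : b ^ 2 = 784 * K ^ 4 := by rw [hb]; ring
    have : 0 < K ^ 4 := by positivity
    rw [e]; linarith
  rw [div_le_iff₀ (by positivity)]
  nlinarith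

/-- Below the threshold set by the least common denominator, each characteristic function value is
estimated through the annulus of `SubgaussianLaw.window`. -/
theorem SubgaussianLaw.prod_charFun_le (h : SubgaussianLaw K ν) {γ α D : ℝ} {x : ι → ℝ}
    (hx : FarFromLattice γ α D x) {u : ℝ} (hu : |u| * (28 * K ^ 2) < 2 * Real.pi * D) :
    ∏ j, ‖charFun ν (u * x j)‖ ≤
      Real.exp (-(2 / (28 * K ^ 2) ^ 2) * min ((γ * (u / (2 * Real.pi))) ^ 2) (α ^ 2)) := by
  have hK := h.pos
  have hpi := Real.pi_pos
  have hwin := h.window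
  set b := 28 * K ^ 2 with hb
  have hb0 : 0 < b := by positivity
  set W : Set (ℝ × ℝ) := {z | 1 ≤ |z.1 - z.2| ∧ |z.1 - z.2| ≤ b} with hW
  have hWm : MeasurableSet W := by
    have : Measurable fun z : ℝ × ℝ => |z.1 - z.2| := by fun_prop
    exact (measurableSet_le measurable_const this).inter (measurableSet_le this measurable_const)
  set M := min ((γ * (u / (2 * Real.pi))) ^ 2) (α ^ 2) with hM
  have hM0 : 0 ≤ M := le_min (sq_nonneg _) (sq_nonneg _)
  have hij : ∀ j, Integrable (fun z : ℝ × ℝ => (1 - Real.cos (u * x j * (z.1 - z.2))) / 2)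
      (ν.prod ν) := by
    intro j
    refine Integrable.div_const ((integrable_const _).sub ?_) 2
    exact (integrable_const (1 : ℝ)).mono' (by fun_prop)
      (Filter.Eventually.of_forall fun z => Real.abs_cos_le_one _)
  set G : ℝ × ℝ → ℝ := fun z => ∑ j, (1 - Real.cos (u * x j * (z.1 - z.2))) / 2 with hG
  have hGi : Integrable G (ν.prod ν) := integrable_finsetSum _ fun j _ => hij j
  have hG0 : ∀ z, 0 ≤ G z := fun z => Finset.sum_nonneg fun j _ => by
    have := Real.cos_le_one (u * x j * (z.1 - z.2))
    linarith
  have hGW : ∀ z ∈ W, 4 * M ≤ G z := by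
    intro z hz
    set θ := |u * (z.1 - z.2)| / (2 * Real.pi) with hθ
    have hθ0 : 0 ≤ θ := by positivity
    -- the cosine is even, so the sign of `u * (z.1 - z.2)` is irrelevant
    have e1 : G z = ∑ j, (1 - Real.cos (2 * Real.pi * (θ * x j))) / 2 := by
      refine Finset.sum_congr rfl fun j _ => ?_
      congr 2
      have : 2 * Real.pi * (θ * x j) = |u * (z.1 - z.2)| * x j := by rw [hθ]; field_simp
      rw [this]
      rcases abs_choice (u * (z.1 - z.2)) with h | h <;> rw [h]
      · congr 1; ring
      · rw [← Real.cos_neg]; congr 1; ring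
    have e2 : 4 * ∑ j, (θ * x j - round (θ * x j)) ^ 2 ≤ G z := by
      rw [e1, Finset.mul_sum]
      refine Finset.sum_le_sum fun j _ => ?_
      linarith [eight_mul_sq_sub_round_le (θ * x j)]
    refine le_trans ?_ e2
    have hθu : |u| / (2 * Real.pi) ≤ θ := by
      rw [hθ, abs_mul]
      gcongr
      exact le_mul_of_one_le_right (abs_nonneg _) hz.1
    rcases hθ0.eq_or_lt with h0 | h0
    · have : u = 0 := by
        have h1 : |u| / (2 * Real.pi) ≤ 0 := h0 ▸ hθu
        have h2 : |u| ≤ 0 := by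
          rw [div_le_iff₀ (by positivity)] at h1; linarith
        exact abs_nonpos_iff.1 h2
      have hMz : M = 0 := by
        refine le_antisymm ((min_le_left _ _).trans ?_) hM0
        rw [this]; simp
      rw [hMz, mul_zero]
      positivity
    · have hD : θ < D := by
        rw [hθ, div_lt_iff₀ (by positivity), abs_mul]
        have := mul_le_mul_of_nonneg_left hz.2 (abs_nonneg u)
        linarith
      have := hx θ h0 hD
      have h3 : M ≤ min ((γ * θ) ^ 2) (α ^ 2) := by
        refine min_le_min ?_ le_rfl
        rw [mul_pow, mul_pow]
        refine mul_le_mul_of_nonneg_left ?_ (sq_nonneg _)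
        rw [← sq_abs, abs_div, abs_of_pos (show 0 < 2 * Real.pi by positivity)]
        gcongr
      linarith
  have hint : 2 / b ^ 2 * M ≤ ∫ z, G z ∂(ν.prod ν) := by
    calc 2 / b ^ 2 * M = 1 / (2 * b ^ 2) * (4 * M) := by field_simp; ring
      _ ≤ (ν.prod ν).real W * (4 * M) := by gcongr
      _ = ∫ z in W, 4 * M ∂(ν.prod ν) := by simp
      _ ≤ ∫ z in W, G z ∂(ν.prod ν) :=
          setIntegral_mono_on (integrable_const _).integrableOn hGi.integrableOn hWm hGW
      _ ≤ _ := setIntegral_le_integral hGi (Filter.Eventually.of_forall hG0)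
  calc ∏ j, ‖charFun ν (u * x j)‖
      ≤ ∏ j, Real.exp (-∫ z : ℝ × ℝ, (1 - Real.cos (u * x j * (z.1 - z.2))) / 2 ∂(ν.prod ν)) :=
        Finset.prod_le_prod (fun _ _ => norm_nonneg _) fun j _ => norm_charFun_le_exp ν _
    _ = Real.exp (-∫ z, G z ∂(ν.prod ν)) := by
        rw [← Real.exp_sum, Finset.sum_neg_distrib, integral_finsetSum _ fun j _ => hij j]
    _ ≤ _ := Real.exp_le_exp.2 (by linarith)

/-- **Small ball estimate.** The Laplace transform of the squared linear form at scale `t` is of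
order `t`, up to errors governed by the least common denominator of the coefficients. -/
theorem SubgaussianLaw.small_ball (h : SubgaussianLaw K ν) {γ α D t : ℝ} (hγ : 0 < γ) (ht : 0 < t)
    (hD : 0 ≤ D) {x : ι → ℝ} (hx : FarFromLattice γ α D x) :
    ∫ y, Real.exp (-(y ⬝ᵥ x) ^ 2 / (2 * t ^ 2)) ∂(Measure.pi fun _ : ι => ν) ≤
      Real.pi * (28 * K ^ 2) * t / γ + Real.exp (-2 * (α / (28 * K ^ 2)) ^ 2)
        + 2 * Real.exp (-(Real.pi * t * D / (28 * K ^ 2)) ^ 2) := by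
  have hK := h.pos
  have hpi := Real.pi_pos
  refine (integral_exp_sq_le_integral_charFun ν x t).trans ?_
  have hpt := fun u hu => h.prod_charFun_le hx (u := u) hu
  set b := 28 * K ^ 2 with hb
  have hb0 : 0 < b := by positivity
  set c := γ ^ 2 / (2 * b ^ 2 * Real.pi ^ 2 * t ^ 2) with hc
  have hc0 : 0 < c := by positivity
  set E := Real.exp (-(Real.pi * t * D / b) ^ 2) with hE
  obtain ⟨i1, v1⟩ := integral_exp_neg_mul_sq_gaussianReal (c := c) (by linarith)
  obtain ⟨i2, v2⟩ := integral_exp_neg_mul_sq_gaussianReal (c := -(1 / 4)) (by norm_num)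
  have pt : ∀ g : ℝ, ∏ j, ‖charFun ν (g / t * x j)‖ ≤ Real.exp (-c * g ^ 2)
      + Real.exp (-2 * (α / b) ^ 2) + E * Real.exp (-(-(1 / 4)) * g ^ 2) := by
    intro g
    have p1 := Real.exp_pos (-c * g ^ 2)
    have p2 := Real.exp_pos (-2 * (α / b) ^ 2)
    have p3 : 0 < E * Real.exp (-(-(1 / 4)) * g ^ 2) := by positivity
    by_cases hg : |g / t| * b < 2 * Real.pi * D
    · have := hpt (g / t) hg
      rcases min_choice ((γ * (g / t / (2 * Real.pi))) ^ 2) (α ^ 2) with hm | hm <;> rw [hm] at this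
      · have e : -(2 / b ^ 2) * (γ * (g / t / (2 * Real.pi))) ^ 2 = -c * g ^ 2 := by
          rw [hc]; field_simp
        rw [e] at this
        linarith
      · have e : -(2 / b ^ 2) * α ^ 2 = -2 * (α / b) ^ 2 := by field_simp
        rw [e] at this
        linarith
    -- beyond the reach of the denominator bound only the Gaussian tail of `g` is used
    · have h1 : ∏ j, ‖charFun ν (g / t * x j)‖ ≤ 1 :=
        Finset.prod_le_one (fun _ _ => norm_nonneg _) fun j _ => norm_charFun_le_one _
      have h2 : 1 ≤ E * Real.exp (-(-(1 / 4)) * g ^ 2) := by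
        rw [hE, ← Real.exp_add]
        apply Real.one_le_exp
        rw [not_lt, abs_div, abs_of_pos ht] at hg
        have h3 : Real.pi * t * D / b ≤ |g| / 2 := by
          rw [div_le_iff₀ hb0]
          have := mul_le_mul_of_nonneg_left hg ht.le
          have e : t * (|g| / t * b) = |g| * b := by field_simp
          rw [e] at this
          linarith
        have h4 : (Real.pi * t * D / b) ^ 2 ≤ (|g| / 2) ^ 2 := by gcongr
        rw [div_pow |g|, sq_abs] at h4
        linarith
      linarith
  have i3 : Integrable (fun g : ℝ => Real.exp (-c * g ^ 2) + Real.exp (-2 * (α / b) ^ 2))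
      (gaussianReal 0 1) := i1.add (integrable_const _)
  have i0 : Integrable (fun g : ℝ => ∏ j, ‖charFun ν (g / t * x j)‖) (gaussianReal 0 1) := by
    refine (integrable_const (1 : ℝ)).mono' ?_ (Filter.Eventually.of_forall fun g => ?_)
    · refine (Finset.measurable_prod _ fun j _ => ?_).aestronglyMeasurable
      exact (measurable_charFun.comp (by fun_prop : Measurable fun g : ℝ => g / t * x j)).norm
    · rw [Real.norm_of_nonneg (Finset.prod_nonneg fun _ _ => norm_nonneg _)]
      exact Finset.prod_le_one (fun _ _ => norm_nonneg _) fun j _ => norm_charFun_le_one _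
  refine (integral_mono i0 (i3.add (i2.const_mul E)) pt).trans ?_
  simp only [Pi.add_apply]
  rw [integral_add i3 (i2.const_mul E), integral_add i1 (integrable_const _), integral_const_mul,
    v1, v2]
  simp only [integral_const, probReal_univ, one_smul]
  have w1 : (√(1 + 2 * c))⁻¹ ≤ Real.pi * b * t / γ := by
    have h5 : γ / (Real.pi * b * t) ≤ √(1 + 2 * c) := by
      apply Real.le_sqrt_of_sq_le
      have : (γ / (Real.pi * b * t)) ^ 2 = 2 * c := by rw [hc]; field_simp
      linarith
    calc (√(1 + 2 * c))⁻¹ ≤ (γ / (Real.pi * b * t))⁻¹ := by gcongr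
      _ = _ := by rw [inv_div]
  have w2 : (√(1 + 2 * -(1 / 4)))⁻¹ ≤ 2 := by
    have : (1 / 2 : ℝ) ≤ √(1 + 2 * -(1 / 4)) := Real.le_sqrt_of_sq_le (by norm_num)
    calc (√(1 + 2 * -(1 / 4)))⁻¹ ≤ (1 / 2 : ℝ)⁻¹ := by gcongr
      _ = 2 := by norm_num
  have hE0 : 0 < E := Real.exp_pos _
  have := mul_le_mul_of_nonneg_left w2 hE0.le
  linarith

end

/-! ### Random matrices and tensorization -/

/-- Exponential Markov inequality for a sum over independent copies; both signs of `l` are allowed,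
so this covers upper and lower deviations. -/
theorem measureReal_pi_sum_le {κ E : Type*} [Fintype κ] [MeasurableSpace E] (P : Measure E)
    [IsProbabilityMeasure P] {f : E → ℝ} {l : ℝ} (hi : Integrable (fun e => Real.exp (l * f e)) P)
    (r : ℝ) :
    (Measure.pi fun _ : κ => P).real {w | l * r ≤ l * ∑ i, f (w i)}
      ≤ Real.exp (-(l * r)) * (∫ e, Real.exp (l * f e) ∂P) ^ Fintype.card κ := by
  have e : ∀ w : κ → E, Real.exp (l * ∑ i, f (w i)) = ∏ i, Real.exp (l * f (w i)) := fun w => by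
    rw [Finset.mul_sum, Real.exp_sum]
  have hI : Integrable (fun w : κ → E => Real.exp (l * ∑ i, f (w i)))
      (Measure.pi fun _ : κ => P) := by
    refine (Integrable.fintype_prod (μ := fun _ : κ => P) (f := fun _ e => Real.exp (l * f e))
      fun _ => hi).congr (Filter.Eventually.of_forall fun w => (e w).symm)
  have h := mul_meas_ge_le_integral_of_nonneg (μ := Measure.pi fun _ : κ => P)
    (f := fun w => Real.exp (l * ∑ i, f (w i))) (Filter.Eventually.of_forall fun w => (Real.exp_pos (l * ∑ i, f (w i))).le) hI
    (Real.exp (l * r))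
  have hs : {w : κ → E | l * r ≤ l * ∑ i, f (w i)}
      = {w | Real.exp (l * r) ≤ Real.exp (l * ∑ i, f (w i))} := by
    ext w; simp
  rw [hs, Real.exp_neg, ← div_eq_inv_mul, le_div_iff₀ (Real.exp_pos _), mul_comm]
  refine h.trans (le_of_eq ?_)
  rw [integral_congr_ae (Filter.Eventually.of_forall e)]
  exact integral_fintype_prod_eq_pow (ι := κ) (μ := P) (fun e => Real.exp (l * f e))

/-- The law of a random matrix, given by its rows, with independent entries of law `ν`. -/
noncomputable abbrev matrixLaw (κ ι : Type*) [Fintype κ] [Fintype ι] (ν : Measure ℝ) :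
    Measure (κ → ι → ℝ) :=
  Measure.pi fun _ : κ => Measure.pi fun _ : ι => ν

open Classical in
/-- The linear map between Euclidean spaces whose matrix has rows `W i`. -/
noncomputable def rowMap {κ ι : Type*} [Fintype κ] [Fintype ι] (W : κ → ι → ℝ) :
    EuclideanSpace ℝ ι →L[ℝ] EuclideanSpace ℝ κ :=
  LinearMap.toContinuousLinearMap (Matrix.toEuclideanLin (Matrix.of W))

/-- An integer vector as a point of Euclidean space. -/
noncomputable def intVec {ι : Type*} [Fintype ι] (p : ι → ℤ) : EuclideanSpace ℝ ι :=
  WithLp.toLp 2 fun j => (p j : ℝ)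

open Classical in
/-- The integer points of the closed Euclidean ball of radius `r` about the origin. -/
noncomputable def latticeBall (ι : Type*) [Fintype ι] (r : ℝ) : Finset (ι → ℤ) :=
  (Fintype.piFinset fun _ => Finset.Icc (-(⌈r⌉₊ : ℤ)) ⌈r⌉₊).filter fun p => ‖intVec p‖ ≤ r

section

variable {κ ι : Type*} [Fintype κ] [Fintype ι]

theorem rowMap_apply (W : κ → ι → ℝ) (x : EuclideanSpace ℝ ι) (i : κ) :
    rowMap W x i = W i ⬝ᵥ x := rfl

theorem norm_rowMap_sq (W : κ → ι → ℝ) (x : EuclideanSpace ℝ ι) :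
    ‖rowMap W x‖ ^ 2 = ∑ i, (W i ⬝ᵥ x) ^ 2 := by
  rw [EuclideanSpace.real_norm_sq_eq]; rfl

/-! ### Counting integer points -/

theorem mem_latticeBall {r : ℝ} {p : ι → ℤ} : p ∈ latticeBall ι r ↔ ‖intVec p‖ ≤ r := by
  classical
  unfold latticeBall
  rw [Finset.mem_filter]
  refine ⟨fun h => h.2, fun h => ⟨?_, h⟩⟩
  rw [Fintype.mem_piFinset]
  intro j
  have h1 : |(p j : ℝ)| ≤ ⌈r⌉₊ := by
    refine le_trans ?_ (h.trans (Nat.le_ceil r))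
    simpa [intVec] using PiLp.norm_apply_le (intVec p) j
  rw [← Int.cast_abs] at h1
  have h2 : |p j| ≤ (⌈r⌉₊ : ℤ) := by exact_mod_cast h1
  rw [Finset.mem_Icc]
  exact abs_le.1 h2

theorem sum_Icc_exp_neg_abs_le {s : ℝ} (hs : 0 < s) (N : ℕ) :
    ∑ k ∈ Finset.Icc (-(N : ℤ)) N, Real.exp (-s * |(k : ℝ)|)
      ≤ 1 + 2 / s * (1 - Real.exp (-s * N)) := by
  induction N with
  | zero => simp
  | succ N ih =>
    have hI : Finset.Icc (-((N + 1 : ℕ) : ℤ)) ((N + 1 : ℕ) : ℤ)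
        = insert ((N : ℤ) + 1) (insert (-((N : ℤ) + 1)) (Finset.Icc (-(N : ℤ)) N)) := by
      ext k
      simp only [Finset.mem_Icc, Finset.mem_insert]
      push_cast
      omega
    rw [hI, Finset.sum_insert, Finset.sum_insert]
    · push_cast
      rw [abs_neg, abs_of_nonneg (by positivity : (0 : ℝ) ≤ (N : ℝ) + 1)]
      have h1 : Real.exp (-s * N) = Real.exp (-s * (N + 1)) * Real.exp s := by
        rw [← Real.exp_add]; congr 1; ring
      have h2 : s + 1 ≤ Real.exp s := Real.add_one_le_exp s
      rw [h1] at ih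
      have h3 := Real.exp_pos (-s * (N + 1))
      have h4 : 2 * Real.exp (-s * (N + 1)) ≤
          2 / s * (Real.exp (-s * (N + 1)) * (Real.exp s - 1)) := by
        rw [div_mul_eq_mul_div, le_div_iff₀ hs]
        nlinarith
      have h5 : 2 / s * (1 - Real.exp (-s * (N + 1))) =
        2 / s * (1 - Real.exp (-s * (N + 1)) * Real.exp s)
          + 2 / s * (Real.exp (-s * (N + 1)) * (Real.exp s - 1)) := by ring
      linarith
    · simp
    · simp only [Finset.mem_Icc, Finset.mem_insert]
      omega

/-- Chernoff bound for the number of integer points of a ball, through its circumscribed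
`ℓ¹` ball. It is exponentially close to `1` for small radii and of the order of the volume for
large ones. -/
theorem card_latticeBall_le {s R : ℝ} (hs : 0 < s) (hR : 0 ≤ R) :
    ((latticeBall ι (R * √(Fintype.card ι))).card : ℝ)
      ≤ (Real.exp (s * R) * (1 + 2 / s)) ^ Fintype.card ι := by
  classical
  set n := Fintype.card ι with hn
  set r := R * √n with hr
  have hl1 : ∀ p ∈ latticeBall ι r, ∑ j, |(p j : ℝ)| ≤ n * R := by
    intro p hp
    rw [mem_latticeBall] at hp
    have h1 : (∑ j, |(p j : ℝ)|) ^ 2 ≤ n * ∑ j, |(p j : ℝ)| ^ 2 := by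
      simpa using sq_sum_le_card_mul_sum_sq (s := Finset.univ) (f := fun j => |(p j : ℝ)|)
    have h2 : ∑ j, |(p j : ℝ)| ^ 2 = ‖intVec p‖ ^ 2 := by
      rw [EuclideanSpace.real_norm_sq_eq]
      exact Finset.sum_congr rfl fun j _ => sq_abs _
    have h3 : ‖intVec p‖ ^ 2 ≤ r ^ 2 := by gcongr
    apply le_of_pow_le_pow_left₀ two_ne_zero (by positivity)
    refine h1.trans ?_
    rw [h2]
    refine (mul_le_mul_of_nonneg_left h3 (by positivity)).trans (le_of_eq ?_)
    rw [hr, mul_pow, Real.sq_sqrt (by positivity)]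
    ring
  calc ((latticeBall ι r).card : ℝ) = ∑ p ∈ latticeBall ι r, 1 := by simp
    _ ≤ ∑ p ∈ latticeBall ι r, Real.exp (n * (s * R)) * ∏ j, Real.exp (-s * |(p j : ℝ)|) := by
        refine Finset.sum_le_sum fun p hp => ?_
        rw [← Real.exp_sum, ← Finset.mul_sum, ← Real.exp_add]
        apply Real.one_le_exp
        nlinarith [hl1 p hp]
    _ ≤ ∑ p ∈ Fintype.piFinset fun _ : ι => Finset.Icc (-(⌈r⌉₊ : ℤ)) ⌈r⌉₊,
          Real.exp (n * (s * R)) * ∏ j, Real.exp (-s * |(p j : ℝ)|) := by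
        refine Finset.sum_le_sum_of_subset_of_nonneg ?_ fun _ _ _ => by positivity
        unfold latticeBall
        exact Finset.filter_subset _ _
    _ = Real.exp (n * (s * R)) *
          (∑ k ∈ Finset.Icc (-(⌈r⌉₊ : ℤ)) ⌈r⌉₊, Real.exp (-s * |(k : ℝ)|)) ^ n := by
        rw [← Finset.mul_sum, ← Finset.prod_univ_sum (fun _ : ι => Finset.Icc (-(⌈r⌉₊ : ℤ)) ⌈r⌉₊)
          (fun _ k => Real.exp (-s * |(k : ℝ)|))]
        simp [hn]
    _ ≤ Real.exp (n * (s * R)) * (1 + 2 / s) ^ n := by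
        gcongr
        refine (sum_Icc_exp_neg_abs_le hs _).trans ?_
        have : 0 < 2 / s * Real.exp (-s * (⌈r⌉₊ : ℕ)) := by positivity
        linarith
    _ = _ := by rw [Real.exp_nat_mul, mul_pow]

/-! ### The operator norm -/

/-- The nearest integer vector. -/
noncomputable def roundVec (x : EuclideanSpace ℝ ι) : ι → ℤ := fun j => round (x j)

theorem norm_sub_roundVec_sq (x : EuclideanSpace ℝ ι) :
    ‖x - intVec (roundVec x)‖ ^ 2 = ∑ j, (x j - round (x j)) ^ 2 := by
  rw [EuclideanSpace.real_norm_sq_eq]; rfl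

theorem norm_sub_roundVec_le (x : EuclideanSpace ℝ ι) :
    ‖x - intVec (roundVec x)‖ ≤ √(Fintype.card ι) / 2 := by
  apply le_of_pow_le_pow_left₀ two_ne_zero (by positivity)
  rw [norm_sub_roundVec_sq, div_pow, Real.sq_sqrt (by positivity)]
  calc ∑ j, (x j - round (x j)) ^ 2 ≤ ∑ _j : ι, (1 / 4 : ℝ) := by
        refine Finset.sum_le_sum fun j _ => ?_
        have := abs_sub_round (x j)
        rw [← sq_abs]
        nlinarith [abs_nonneg (x j - round (x j))]
    _ = _ := by simp; ring

/-- The integer points, scaled by `√n`, are a `1/2`-net of the unit ball. -/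
theorem opNorm_le_of_latticeBall [Nonempty ι] (A : EuclideanSpace ℝ ι →L[ℝ] EuclideanSpace ℝ κ)
    {B : ℝ} (hB : 0 ≤ B) (h : ∀ p ∈ latticeBall ι (3 / 2 * √(Fintype.card ι)),
      ‖A (intVec p)‖ ≤ B * √(Fintype.card ι)) : ‖A‖ ≤ 2 * B := by
  set n := Fintype.card ι with hn
  have hn0 : 0 < √(n : ℝ) := by
    have : 0 < n := Fintype.card_pos
    positivity
  have key : ∀ u : EuclideanSpace ℝ ι, ‖u‖ = 1 → ‖A u‖ ≤ B + ‖A‖ / 2 := by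
    intro u hu
    set v := √(n : ℝ) • u with hv
    have hvn : ‖v‖ = √n := by rw [hv, norm_smul, hu, Real.norm_of_nonneg hn0.le, mul_one]
    have h1 := norm_sub_roundVec_le v
    have hp : roundVec v ∈ latticeBall ι (3 / 2 * √n) := by
      rw [mem_latticeBall]
      have : ‖intVec (roundVec v)‖ ≤ ‖v‖ + ‖v - intVec (roundVec v)‖ := by
        have := norm_sub_le v (v - intVec (roundVec v))
        simpa using this
      linarith
    have h2 : ‖A v‖ ≤ B * √n + ‖A‖ * (√n / 2) := by
      have : A v = A (intVec (roundVec v)) + A (v - intVec (roundVec v)) := by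
        rw [← map_add]; simp
      rw [this]
      refine (norm_add_le _ _).trans (add_le_add (h _ hp) ((A.le_opNorm _).trans ?_))
      gcongr
    rw [hv, map_smul, norm_smul, Real.norm_of_nonneg hn0.le] at h2
    have h3 : √n * ‖A u‖ ≤ √n * (B + ‖A‖ / 2) := by linarith
    exact le_of_mul_le_mul_left h3 hn0
  have : ‖A‖ ≤ B + ‖A‖ / 2 := by
    refine A.opNorm_le_bound (by positivity) fun x => ?_
    by_cases hx : x = 0
    · simp [hx]
    · have hx' : 0 < ‖x‖ := norm_pos_iff.2 hx
      have h1 := key (‖x‖⁻¹ • x) (by rw [norm_smul, norm_inv, norm_norm, inv_mul_cancel₀ hx'.ne'])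
      rw [map_smul, norm_smul, norm_inv, norm_norm, inv_mul_le_iff₀ hx'] at h1
      linarith
  linarith

variable {K : ℝ} {ν : Measure ℝ} [IsProbabilityMeasure ν]

/-- The operator norm of a matrix with independent subgaussian entries is of order `√n`. -/
theorem SubgaussianLaw.opNorm_tail [Nonempty ι] (h : SubgaussianLaw K ν)
    (hc : Fintype.card κ ≤ Fintype.card ι) :
    (matrixLaw κ ι ν).real {W | 38 * K * √(Fintype.card ι) < ‖rowMap W‖}
      ≤ Real.exp (-Fintype.card ι) := by
  have hK := h.pos
  set n := Fintype.card ι with hn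
  have hnpos : 0 < n := Fintype.card_pos
  have hn0 : 0 < √(n : ℝ) := by positivity
  have hsub : {W : κ → ι → ℝ | 38 * K * √n < ‖rowMap W‖} ⊆
      ⋃ p ∈ latticeBall ι (3 / 2 * √n), {W | 19 * K * √n * √n < ‖rowMap W (intVec p)‖} := by
    intro W hW
    by_contra hcon
    have hle : ∀ p ∈ latticeBall ι (3 / 2 * √n),
        ‖rowMap W (intVec p)‖ ≤ 19 * K * √n * √n := by
      intro p hp
      by_contra hlt
      exact hcon (Set.mem_biUnion hp (not_le.1 hlt))
    have := opNorm_le_of_latticeBall (rowMap W) (B := 19 * K * √n) (by positivity) hle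
    have hW : 38 * K * √n < ‖rowMap W‖ := hW
    linarith
  have hpt : ∀ p ∈ latticeBall ι (3 / 2 * √n),
      (matrixLaw κ ι ν).real {W | 19 * K * √n * √n < ‖rowMap W (intVec p)‖}
        ≤ Real.exp (-5 * n) * 3 ^ n := by
    intro p hp
    rw [mem_latticeBall] at hp
    set x : EuclideanSpace ℝ ι := (3 / 2 * √n)⁻¹ • intVec p with hx
    have hx1 : ∑ j, x j ^ 2 ≤ 1 := by
      rw [← EuclideanSpace.real_norm_sq_eq, hx, norm_smul, norm_inv,
        Real.norm_of_nonneg (by positivity)]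
      apply pow_le_one₀ (by positivity)
      rw [inv_mul_le_iff₀ (by positivity)]
      linarith
    obtain ⟨i1, v1⟩ := h.exp_sq_moment hx1
    have e : ∀ y : ι → ℝ, (y ⬝ᵥ x) ^ 2 / (32 * K ^ 2) = 1 / (32 * K ^ 2) * (y ⬝ᵥ x) ^ 2 :=
      fun y => by ring
    simp only [e] at i1 v1
    have h1 := measureReal_pi_sum_le (κ := κ) (Measure.pi fun _ : ι => ν) i1 (160 * K ^ 2 * n)
    have hs : {W : κ → ι → ℝ | 19 * K * √n * √n < ‖rowMap W (intVec p)‖} ⊆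
        {w | 1 / (32 * K ^ 2) * (160 * K ^ 2 * n) ≤ 1 / (32 * K ^ 2) * ∑ i, (w i ⬝ᵥ x) ^ 2} := by
      intro W hW
      have hW : 19 * K * √n * √n < ‖rowMap W (intVec p)‖ := hW
      refine mul_le_mul_of_nonneg_left ?_ (by positivity : (0 : ℝ) ≤ 1 / (32 * K ^ 2))
      change _ ≤ ∑ i, (W i ⬝ᵥ x) ^ 2
      have h5 : 0 ≤ 3 / 2 * √(n : ℝ) := by positivity
      rw [← norm_rowMap_sq, hx, map_smul, norm_smul, norm_inv, Real.norm_of_nonneg h5, mul_pow]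
      have h2 : (19 * K * √n * √n) ^ 2 ≤ ‖rowMap W (intVec p)‖ ^ 2 := by gcongr
      have h3 : (19 * K * √n * √n) ^ 2 = 361 * K ^ 2 * n * n := by
        rw [mul_assoc, Real.mul_self_sqrt (by positivity)]; ring
      have h4 : (3 / 2 * √(n : ℝ)) ^ 2 = 9 / 4 * n := by
        rw [mul_pow, Real.sq_sqrt (by positivity)]; ring
      rw [inv_pow, h4, ← div_eq_inv_mul, le_div_iff₀ (by positivity)]
      refine le_trans ?_ (h3 ▸ h2)
      have : 0 ≤ K ^ 2 * (n : ℝ) * n := by positivity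
      nlinarith
    refine (measureReal_mono hs).trans (h1.trans ?_)
    -- the factor `exp (-5 n)` pays for the `3 ^ n` moments and the `(3 exp (3 / 2)) ^ n` net points
    have e2 : -(1 / (32 * K ^ 2) * (160 * K ^ 2 * (n : ℝ))) = -5 * n := by field_simp; norm_num
    rw [e2]
    refine mul_le_mul_of_nonneg_left ?_ (Real.exp_pos _).le
    calc (∫ y, Real.exp (1 / (32 * K ^ 2) * (y ⬝ᵥ x) ^ 2) ∂(Measure.pi fun _ : ι => ν)) ^
          Fintype.card κ ≤ (3 : ℝ) ^ Fintype.card κ :=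
          pow_le_pow_left₀ (integral_nonneg (μ := Measure.pi fun _ : ι => ν)
            (f := fun y => Real.exp (1 / (32 * K ^ 2) * (y ⬝ᵥ x) ^ 2))
            fun y => (Real.exp_pos _).le) v1 _
      _ ≤ 3 ^ n := pow_le_pow_right₀ (by norm_num) hc
  calc _ ≤ (matrixLaw κ ι ν).real (⋃ p ∈ latticeBall ι (3 / 2 * √n),
          {W | 19 * K * √n * √n < ‖rowMap W (intVec p)‖}) := measureReal_mono hsub (measure_ne_top _ _)
    _ ≤ ∑ p ∈ latticeBall ι (3 / 2 * √n),
          (matrixLaw κ ι ν).real {W | 19 * K * √n * √n < ‖rowMap W (intVec p)‖} :=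
        measureReal_biUnion_finset_le _ _
    _ ≤ ∑ p ∈ latticeBall ι (3 / 2 * √n), Real.exp (-5 * n) * 3 ^ n := Finset.sum_le_sum hpt
    _ = (latticeBall ι (3 / 2 * √n)).card * (Real.exp (-5 * n) * 3 ^ n) := by simp
    _ ≤ (Real.exp (1 * (3 / 2)) * (1 + 2 / 1)) ^ n * (Real.exp (-5 * n) * 3 ^ n) := by
        gcongr
        exact card_latticeBall_le one_pos (by norm_num)
    _ ≤ (Real.exp (1 * (3 / 2)) * Real.exp (5 / 4)) ^ n *
          (Real.exp (-5 * n) * Real.exp (5 / 4) ^ n) := by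
        have := three_le_exp
        gcongr
        linarith
    _ = Real.exp (-n) := by
        rw [← Real.exp_add, ← Real.exp_nat_mul, ← Real.exp_nat_mul, ← Real.exp_add, ← Real.exp_add]
        congr 1; ring

end

/-! ### Normal vectors with a small common denominator -/

section

variable {κ ι : Type*} [Fintype κ] [Fintype ι]
variable {K : ℝ} {ν : Measure ℝ} [IsProbabilityMeasure ν]

/-- A fixed unit vector is mapped to a vector shorter than `√n / 4` with exponentially small
probability. -/
theorem SubgaussianLaw.crude_point (h : SubgaussianLaw K ν)
    (hc : Fintype.card ι ≤ 2 * Fintype.card κ) {l : ℝ} (hl : l = 1 / (6144 * K ^ 4))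
    {x : EuclideanSpace ℝ ι} (hx : ‖x‖ = 1) :
    (matrixLaw κ ι ν).real {W | ‖rowMap W x‖ ≤ √(Fintype.card ι) / 4}
      ≤ Real.exp (-(l / 8) * Fintype.card ι) := by
  have hK := h.pos
  have hl0 : 0 < l := by rw [hl]; positivity
  set n := Fintype.card ι with hn
  have hx1 : ∑ j, x j ^ 2 = 1 := by rw [← EuclideanSpace.real_norm_sq_eq, hx, one_pow]
  have hE := h.crude_laplace hx1 hl
  have hi : Integrable (fun y : ι → ℝ => Real.exp (-l * (y ⬝ᵥ x) ^ 2))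
      (Measure.pi fun _ : ι => ν) := by
    have hm := measurable_dotProduct_right (ι := ι) x
    refine (integrable_const (1 : ℝ)).mono' (by fun_prop) (Filter.Eventually.of_forall fun y => ?_)
    rw [Real.norm_of_nonneg (by positivity)]
    exact Real.exp_le_one_iff.2 (by nlinarith [sq_nonneg (y ⬝ᵥ x)])
  have h1 := measureReal_pi_sum_le (κ := κ) (Measure.pi fun _ : ι => ν) hi (n / 16)
  have hs : {W : κ → ι → ℝ | ‖rowMap W x‖ ≤ √n / 4} ⊆
      {w | -l * (n / 16) ≤ -l * ∑ i, (w i ⬝ᵥ x) ^ 2} := by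
    intro W hW
    have hW : ‖rowMap W x‖ ≤ √n / 4 := hW
    change -l * (n / 16) ≤ -l * ∑ i, (W i ⬝ᵥ x) ^ 2
    rw [← norm_rowMap_sq]
    have h2 : ‖rowMap W x‖ ^ 2 ≤ (√n / 4) ^ 2 := by gcongr
    rw [div_pow, Real.sq_sqrt (by positivity)] at h2
    nlinarith
  refine (measureReal_mono hs).trans (h1.trans ?_)
  have h3 : (∫ y, Real.exp (-l * (y ⬝ᵥ x) ^ 2) ∂(Measure.pi fun _ : ι => ν)) ^ Fintype.card κ
      ≤ Real.exp (-(l / 2)) ^ Fintype.card κ := by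
    refine pow_le_pow_left₀ (integral_nonneg (μ := Measure.pi fun _ : ι => ν)
      (f := fun y => Real.exp (-l * (y ⬝ᵥ x) ^ 2)) fun y => (Real.exp_pos _).le) ?_ _
    have := Real.add_one_le_exp (-(l / 2))
    linarith
  refine (mul_le_mul_of_nonneg_left h3 (Real.exp_pos _).le).trans ?_
  rw [← Real.exp_nat_mul, ← Real.exp_add]
  apply Real.exp_le_exp.2
  have hc' : (n : ℝ) ≤ 2 * Fintype.card κ := by exact_mod_cast hc
  nlinarith

/-- Few integer points are short, so none of them is almost annihilated by the random matrix. -/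
theorem SubgaussianLaw.short_lattice (h : SubgaussianLaw K ν)
    (hc : Fintype.card ι ≤ 2 * Fintype.card κ) {l : ℝ} (hl : l = 1 / (6144 * K ^ 4)) :
    (matrixLaw κ ι ν).real {W | ∃ p ∈ latticeBall ι (2 * (l ^ 2 / 8192) * √(Fintype.card ι)),
        intVec p ≠ 0 ∧ ‖rowMap W (intVec p)‖ ≤ √(Fintype.card ι) / 4 * ‖intVec p‖}
      ≤ Real.exp (-(l / 16) * Fintype.card ι) := by
  have hK := h.pos
  have hl0 : 0 < l := by rw [hl]; positivity
  set n := Fintype.card ι with hn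
  set F := latticeBall ι (2 * (l ^ 2 / 8192) * √n) with hF
  have hsub : {W : κ → ι → ℝ | ∃ p ∈ F, intVec p ≠ 0 ∧
      ‖rowMap W (intVec p)‖ ≤ √n / 4 * ‖intVec p‖} ⊆
      ⋃ p ∈ F, {W | intVec p ≠ 0 ∧ ‖rowMap W (intVec p)‖ ≤ √n / 4 * ‖intVec p‖} := by
    rintro W ⟨p, hp, hW⟩
    exact Set.mem_biUnion hp hW
  have hpt : ∀ p ∈ F, (matrixLaw κ ι ν).real {W | intVec p ≠ 0 ∧
      ‖rowMap W (intVec p)‖ ≤ √n / 4 * ‖intVec p‖} ≤ Real.exp (-(l / 8) * n) := by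
    intro p _
    by_cases hp : intVec p = 0
    · simp only [hp, ne_eq, not_true_eq_false, false_and]
      simp
      positivity
    · have hp' : 0 < ‖intVec p‖ := norm_pos_iff.2 hp
      refine (measureReal_mono ?_ (measure_ne_top _ _)).trans
        (h.crude_point hc hl (x := ‖intVec p‖⁻¹ • intVec p)
          (by rw [norm_smul, norm_inv, norm_norm, inv_mul_cancel₀ hp'.ne']))
      rintro W ⟨_, hW⟩
      change ‖rowMap W _‖ ≤ _
      rw [map_smul, norm_smul, norm_inv, norm_norm, inv_mul_le_iff₀ hp']
      linarith
  refine (measureReal_mono hsub (measure_ne_top _ _)).trans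
    ((measureReal_biUnion_finset_le _ _).trans ((Finset.sum_le_sum hpt).trans ?_))
  rw [Finset.sum_const, nsmul_eq_mul]
  -- with this Chernoff parameter the count is at most `exp (l n / 16)`, half the crude exponent
  have hcard := card_latticeBall_le (ι := ι) (s := 64 / l) (R := 2 * (l ^ 2 / 8192))
    (by positivity) (by positivity)
  rw [← hn, ← hF] at hcard
  have e : Real.exp (64 / l * (2 * (l ^ 2 / 8192))) * (1 + 2 / (64 / l)) ≤ Real.exp (l / 16) := by
    have h1 := Real.add_one_le_exp (2 / (64 / l))
    calc _ ≤ Real.exp (64 / l * (2 * (l ^ 2 / 8192))) * Real.exp (2 / (64 / l)) := by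
          gcongr; linarith
      _ = Real.exp (64 / l * (2 * (l ^ 2 / 8192)) + 2 / (64 / l)) := (Real.exp_add _ _).symm
      _ ≤ _ := by
          apply Real.exp_le_exp.2
          have e1 : 64 / l * (2 * (l ^ 2 / 8192)) = l / 64 := by field_simp; norm_num
          have e2 : 2 / (64 / l) = l / 32 := by field_simp; norm_num
          rw [e1, e2]; linarith
  calc (F.card : ℝ) * Real.exp (-(l / 8) * n) ≤ Real.exp (l / 16) ^ n * Real.exp (-(l / 8) * n) := by
        gcongr
        exact hcard.trans (pow_le_pow_left₀ (by positivity) e n)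
    _ = _ := by
        rw [← Real.exp_nat_mul, ← Real.exp_add]
        congr 1; ring

theorem exists_near_of_not_farFromLattice {γ α D : ℝ} {x : EuclideanSpace ℝ ι}
    (h : ¬ FarFromLattice γ α D x) : ∃ θ, 0 < θ ∧ θ < D ∧
      ‖θ • x - intVec (roundVec (θ • x))‖ ^ 2 < (γ * θ) ^ 2 ∧
      ‖θ • x - intVec (roundVec (θ • x))‖ ^ 2 < α ^ 2 := by
  unfold FarFromLattice at h
  push Not at h
  obtain ⟨θ, h0, h1, h2⟩ := h
  refine ⟨θ, h0, h1, ?_⟩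
  rw [norm_sub_roundVec_sq]
  exact lt_min_iff.1 h2

/-- A unit vector in the kernel whose multiple `θ • x` with small `θ` is close to the lattice leads
to a short integer point almost annihilated by the matrix. -/
theorem exists_short_lattice_of_not_far {W : κ → ι → ℝ} (hK : 0 < K)
    (hW : ‖rowMap W‖ ≤ 38 * K * √(Fintype.card ι)) {x : EuclideanSpace ℝ ι} (hx : ‖x‖ = 1)
    (hWx : rowMap W x = 0) {γ α R : ℝ} (hγ : 0 < γ) (hγ2 : γ ≤ 1 / 2) (hγK : γ ≤ 1 / (304 * K))
    (hfar : ¬ FarFromLattice γ α (R * √(Fintype.card ι)) x) :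
    ∃ p ∈ latticeBall ι (2 * R * √(Fintype.card ι)), intVec p ≠ 0 ∧
      ‖rowMap W (intVec p)‖ ≤ √(Fintype.card ι) / 4 * ‖intVec p‖ := by
  set n := Fintype.card ι with hn
  obtain ⟨θ, h0, h1, h2, -⟩ := exists_near_of_not_farFromLattice hfar
  have h2 : ‖θ • x - intVec (roundVec (θ • x))‖ < γ * θ :=
    lt_of_pow_lt_pow_left₀ 2 (by positivity) h2
  set p := roundVec (θ • x) with hp
  have hθ : ‖θ • x‖ = θ := by rw [norm_smul, hx, mul_one, Real.norm_of_nonneg h0.le]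
  have h3 : θ ≤ ‖intVec p‖ + ‖θ • x - intVec p‖ := by
    have := norm_add_le (intVec p) (θ • x - intVec p)
    rwa [add_sub_cancel, hθ] at this
  have h4 : ‖intVec p‖ ≤ θ + ‖θ • x - intVec p‖ := by
    have := norm_sub_le (θ • x) (θ • x - intVec p)
    rwa [sub_sub_cancel, hθ] at this
  have h5 : γ * θ ≤ θ / 2 := by nlinarith
  have h6 : θ / 2 < ‖intVec p‖ := by linarith
  refine ⟨p, ?_, ?_, ?_⟩
  · rw [mem_latticeBall]; linarith
  · exact norm_pos_iff.1 (by linarith)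
  · have e : rowMap W (intVec p) = -rowMap W (θ • x - intVec p) := by
      rw [map_sub, map_smul, hWx]; simp
    rw [e, norm_neg]
    have hγK' : 304 * K * γ ≤ 1 := by
      rw [le_div_iff₀ (by positivity)] at hγK; linarith
    calc ‖rowMap W (θ • x - intVec p)‖ ≤ ‖rowMap W‖ * ‖θ • x - intVec p‖ :=
          (rowMap W).le_opNorm _
      _ ≤ 38 * K * √n * (γ * θ) := by gcongr
      _ = √n / 8 * θ * (304 * K * γ) := by ring
      _ ≤ √n / 8 * θ * 1 := by gcongr
      _ ≤ √n / 4 * ‖intVec p‖ := by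
          have : 0 ≤ √(n : ℝ) := by positivity
          nlinarith

/-- The matrices of norm `O(√n)` that have a unit kernel vector whose least common denominator lies
between `T` and `2 * T`. -/
def levelSet (κ ι : Type*) [Fintype κ] [Fintype ι] (K γ α T : ℝ) : Set (κ → ι → ℝ) :=
  {W | ‖rowMap W‖ ≤ 38 * K * √(Fintype.card ι) ∧ ∃ x : EuclideanSpace ℝ ι, ‖x‖ = 1 ∧
    rowMap W x = 0 ∧ FarFromLattice γ α T x ∧ ¬ FarFromLattice γ α (2 * T) x}

/-- The unit vectors whose multiple `θ • y`, for some `θ ∈ [T, 2T)`, is within `α` of the integer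
point `p`, but which are far from the lattice up to `T`. -/
def nearUnitVec {ι : Type*} [Fintype ι] (γ α T : ℝ) (p : ι → ℤ) : Set (EuclideanSpace ℝ ι) :=
  {y | ‖y‖ = 1 ∧ FarFromLattice γ α T y ∧ ∃ θ, T ≤ θ ∧ θ < 2 * T ∧ ‖θ • y - intVec p‖ < α}

/-- A kernel vector `x` of least common denominator about `T` shares its nearest integer point `p`
with any other `y ∈ nearUnitVec γ α T p`, so `y` is almost annihilated by the matrix. -/
theorem exists_lattice_of_mem_levelSet {γ α T : ℝ} (hα : 0 < α) (hT : 0 < T) (hαT : α ≤ T)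
    {W : κ → ι → ℝ} (hW : W ∈ levelSet κ ι K γ α T) :
    ∃ p ∈ latticeBall ι (3 * T), (nearUnitVec γ α T p).Nonempty ∧
      ∀ y ∈ nearUnitVec γ α T p,
        ‖rowMap W y‖ ≤ 76 * K * √(Fintype.card ι) * α / T := by
  obtain ⟨hWn, x, hx, hWx, hfar, hnf⟩ := hW
  obtain ⟨θ, h0, h1, h2, h2'⟩ := exists_near_of_not_farFromLattice hnf
  have hθT : T ≤ θ := by
    by_contra hlt
    have := hfar θ h0 (not_le.1 hlt)
    have e := norm_sub_roundVec_sq (θ • x)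
    rcases min_choice ((γ * θ) ^ 2) (α ^ 2) with hm | hm <;> rw [hm] at this
    · exact absurd (e ▸ h2) (not_lt.2 this)
    · exact absurd (e ▸ h2') (not_lt.2 this)
  have h3 : ‖θ • x - intVec (roundVec (θ • x))‖ < α := lt_of_pow_lt_pow_left₀ 2 hα.le h2'
  set p := roundVec (θ • x) with hp
  have hθ : ‖θ • x‖ = θ := by rw [norm_smul, hx, mul_one, Real.norm_of_nonneg h0.le]
  have h4 : ‖intVec p‖ ≤ θ + ‖θ • x - intVec p‖ := by
    have := norm_sub_le (θ • x) (θ • x - intVec p)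
    rwa [sub_sub_cancel, hθ] at this
  refine ⟨p, mem_latticeBall.2 (by linarith), ⟨x, hx, hfar, θ, hθT, h1, h3⟩, ?_⟩
  rintro y ⟨-, -, θ', hT', -, h5⟩
  have h6 : ‖rowMap W (θ • x - intVec p)‖ ≤ 38 * K * √(Fintype.card ι) * α :=
    ((rowMap W).le_opNorm _).trans (mul_le_mul hWn h3.le (norm_nonneg _)
      ((norm_nonneg _).trans hWn))
  have h7 : ‖rowMap W (θ' • y - intVec p)‖ ≤ 38 * K * √(Fintype.card ι) * α :=
    ((rowMap W).le_opNorm _).trans (mul_le_mul hWn h5.le (norm_nonneg _)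
      ((norm_nonneg _).trans hWn))
  have e : θ' • rowMap W y = rowMap W (θ' • y - intVec p) - rowMap W (θ • x - intVec p) := by
    rw [map_sub, map_sub, map_smul, map_smul, hWx]; simp
  have h8 : θ' * ‖rowMap W y‖ ≤ 76 * K * √(Fintype.card ι) * α := by
    have := norm_sub_le (rowMap W (θ' • y - intVec p)) (rowMap W (θ • x - intVec p))
    rw [← e, norm_smul, Real.norm_of_nonneg (by linarith)] at this
    linarith
  rw [le_div_iff₀ hT]
  nlinarith [norm_nonneg (rowMap W y)]

/-- Tensorized small ball estimate: every row contributes one factor. -/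
theorem SubgaussianLaw.laplace_pow (h : SubgaussianLaw K ν) {γ α T t : ℝ} (hγ : 0 < γ)
    (hT : 0 ≤ T) (ht : 0 < t) {y : EuclideanSpace ℝ ι} (hy : FarFromLattice γ α T y) :
    (matrixLaw κ ι ν).real {W | ‖rowMap W y‖ ≤ t * √(Fintype.card ι)} ≤
      Real.exp (Fintype.card ι / 2) *
        (Real.pi * (28 * K ^ 2) * t / γ + Real.exp (-2 * (α / (28 * K ^ 2)) ^ 2)
          + 2 * Real.exp (-(Real.pi * t * T / (28 * K ^ 2)) ^ 2)) ^ Fintype.card κ := by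
  set n := Fintype.card ι with hn
  have hsb := h.small_ball hγ ht hT hy
  have e : ∀ z : ι → ℝ, -(z ⬝ᵥ y) ^ 2 / (2 * t ^ 2) = -(1 / (2 * t ^ 2)) * (z ⬝ᵥ y) ^ 2 :=
    fun z => by ring
  simp only [e] at hsb
  have hi : Integrable (fun z : ι → ℝ => Real.exp (-(1 / (2 * t ^ 2)) * (z ⬝ᵥ y) ^ 2))
      (Measure.pi fun _ : ι => ν) := by
    have hm := measurable_dotProduct_right (ι := ι) y
    refine (integrable_const (1 : ℝ)).mono' (by fun_prop) (Filter.Eventually.of_forall fun z => ?_)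
    rw [Real.norm_of_nonneg (by positivity)]
    refine Real.exp_le_one_iff.2 ?_
    have : 0 ≤ 1 / (2 * t ^ 2) * (z ⬝ᵥ y) ^ 2 := by positivity
    linarith
  have h1 := measureReal_pi_sum_le (κ := κ) (Measure.pi fun _ : ι => ν) hi (t ^ 2 * n)
  have hs : {W : κ → ι → ℝ | ‖rowMap W y‖ ≤ t * √n} ⊆
      {w | -(1 / (2 * t ^ 2)) * (t ^ 2 * n) ≤ -(1 / (2 * t ^ 2)) * ∑ i, (w i ⬝ᵥ y) ^ 2} := by
    intro W hW
    have hW : ‖rowMap W y‖ ≤ t * √n := hW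
    change -(1 / (2 * t ^ 2)) * (t ^ 2 * n) ≤ -(1 / (2 * t ^ 2)) * ∑ i, (W i ⬝ᵥ y) ^ 2
    rw [← norm_rowMap_sq, neg_mul, neg_mul, neg_le_neg_iff]
    have h2 : ‖rowMap W y‖ ^ 2 ≤ (t * √n) ^ 2 := by gcongr
    rw [mul_pow, Real.sq_sqrt (by positivity)] at h2
    gcongr
  refine (measureReal_mono hs).trans (h1.trans ?_)
  have e2 : -(-(1 / (2 * t ^ 2)) * (t ^ 2 * n)) = (n : ℝ) / 2 := by field_simp
  rw [e2]
  refine mul_le_mul_of_nonneg_left ?_ (Real.exp_pos _).le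
  exact pow_le_pow_left₀ (integral_nonneg (μ := Measure.pi fun _ : ι => ν)
      (f := fun z => Real.exp (-(1 / (2 * t ^ 2)) * (z ⬝ᵥ y) ^ 2)) fun y => (Real.exp_pos _).le)
      hsb _

/-- Union bound over a lattice net for one dyadic level of the least common denominator. -/
theorem SubgaussianLaw.measure_levelSet (h : SubgaussianLaw K ν) [Nonempty ι] {γ μ R : ℝ}
    (hγ : 0 < γ) (hμ : 0 < μ) (hR : 0 < R) (hμR : μ ≤ R) :
    (matrixLaw κ ι ν).real
        (levelSet κ ι K γ (μ * √(Fintype.card ι)) (R * √(Fintype.card ι))) ≤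
      (Real.exp 1 * (1 + 6 * R)) ^ Fintype.card ι * (Real.exp (Fintype.card ι / 2) *
        (Real.pi * (28 * K ^ 2) * (76 * K * μ / R) / γ
          + Real.exp (-2 * (μ * √(Fintype.card ι) / (28 * K ^ 2)) ^ 2)
          + 2 * Real.exp (-(Real.pi * (76 * K * μ * √(Fintype.card ι)) / (28 * K ^ 2)) ^ 2))
            ^ Fintype.card κ) := by
  have hK := h.pos
  set n := Fintype.card ι with hn
  have hnpos : 0 < n := Fintype.card_pos
  have hn0 : 0 < √(n : ℝ) := by positivity
  set α := μ * √n with hα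
  set T := R * √n with hT
  set F := latticeBall ι (3 * T) with hF
  set t := 76 * K * μ / R with ht
  have ht0 : 0 < t := by positivity
  have htT : Real.pi * t * T = Real.pi * (76 * K * μ * √n) := by rw [ht, hT]; field_simp
  have hsub : levelSet κ ι K γ α T ⊆ ⋃ p ∈ F, {W | (nearUnitVec γ α T p).Nonempty ∧
      ∀ y ∈ nearUnitVec γ α T p, ‖rowMap W y‖ ≤ t * √n} := by
    intro W hW
    obtain ⟨p, hp, hne, hy⟩ := exists_lattice_of_mem_levelSet (by positivity) (by positivity)
      (mul_le_mul_of_nonneg_right hμR hn0.le) hW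
    refine Set.mem_biUnion hp ⟨hne, fun y hyp => (hy y hyp).trans (le_of_eq ?_)⟩
    rw [← hn, ht]
    field_simp
  set E := Real.exp (n / 2) *
        (Real.pi * (28 * K ^ 2) * t / γ + Real.exp (-2 * (α / (28 * K ^ 2)) ^ 2)
          + 2 * Real.exp (-(Real.pi * t * T / (28 * K ^ 2)) ^ 2)) ^ Fintype.card κ with hE
  have hE0 : 0 ≤ E := by have := Real.pi_pos; positivity
  have hpt : ∀ p ∈ F, (matrixLaw κ ι ν).real {W | (nearUnitVec γ α T p).Nonempty ∧
      ∀ y ∈ nearUnitVec γ α T p, ‖rowMap W y‖ ≤ t * √n} ≤ E := by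
    intro p _
    by_cases hne : (nearUnitVec γ α T p).Nonempty
    · obtain ⟨y, hy⟩ := hne
      refine (measureReal_mono ?_ (measure_ne_top _ _)).trans
        (h.laplace_pow hγ (by positivity : 0 ≤ T) ht0 hy.2.1)
      rintro W ⟨_, hW⟩
      exact hW y hy
    · simp only [hne, false_and]
      simpa using hE0
  rw [← htT]
  refine (measureReal_mono hsub (measure_ne_top _ _)).trans
    ((measureReal_biUnion_finset_le _ _).trans ((Finset.sum_le_sum hpt).trans ?_))
  rw [Finset.sum_const, nsmul_eq_mul]
  refine mul_le_mul_of_nonneg_right ?_ hE0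
  have hcard := card_latticeBall_le (ι := ι) (s := 1 / (3 * R)) (R := 3 * R)
    (by positivity) (by positivity)
  rw [← hn, mul_assoc, ← hT, ← hF] at hcard
  refine hcard.trans (le_of_eq ?_)
  congr 2
  · congr 1; field_simp
  · field_simp; ring

end

/-! ### Union bound over the levels -/

section

variable {κ ι : Type*} [Fintype κ] [Fintype ι]

/-- Ascending through the dyadic levels of the least common denominator. -/
theorem farFromLattice_of_levels {K γ α R : ℝ} {W : κ → ι → ℝ}
    (hW : ‖rowMap W‖ ≤ 38 * K * √(Fintype.card ι)) {x : EuclideanSpace ℝ ι} (hx : ‖x‖ = 1)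
    (hWx : rowMap W x = 0) (h0 : FarFromLattice γ α (R * √(Fintype.card ι)) x) (L : ℕ)
    (hL : ∀ k < L, W ∉ levelSet κ ι K γ α (2 ^ k * R * √(Fintype.card ι))) :
    FarFromLattice γ α (2 ^ L * R * √(Fintype.card ι)) x := by
  induction L with
  | zero => simpa using h0
  | succ L ih =>
    have ih := ih fun k hk => hL k (hk.trans (Nat.lt_succ_self L))
    by_contra hcon
    refine hL L (Nat.lt_succ_self L) ⟨hW, x, hx, hWx, ih, ?_⟩
    rw [pow_succ] at hcon
    convert hcon using 2
    ring

end

/-- The estimate of `SubgaussianLaw.measure_levelSet` at the level `2 ^ k * R`, once the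
exponentially small errors are absorbed into the main term. -/
theorem SubgaussianLaw.measure_levelSet_dyadic {K : ℝ} {ν : Measure ℝ} [IsProbabilityMeasure ν]
    (h : SubgaussianLaw K ν) {γ μ R A : ℝ} (hγ : 0 < γ) (hμ : 0 < μ) (hR : 0 < R)
    (hμR : μ ≤ R) (hA : A = Real.pi * (28 * K ^ 2) * (76 * K) / γ)
    (hμA : Real.exp 4 * (1 + 6 * R) * (2 * A * μ / R) ≤ 1) {m k : ℕ}
    (hsmall : Real.exp (-2 * (μ * √(Fintype.card (Fin (m + 1))) / (28 * K ^ 2)) ^ 2)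
          + 2 * Real.exp (-(Real.pi * (76 * K * μ * √(Fintype.card (Fin (m + 1))))
            / (28 * K ^ 2)) ^ 2) ≤ A * (μ / (2 ^ k * R))) :
    (matrixLaw (Fin m) (Fin (m + 1)) ν).real (levelSet (Fin m) (Fin (m + 1)) K γ
        (μ * √(Fintype.card (Fin (m + 1)))) (2 ^ k * R * √(Fintype.card (Fin (m + 1)))))
      ≤ Real.exp 4 * (1 + 6 * R) * 2 ^ k * Real.exp (-(5 / 2) * (m + 1)) := by
  have hK := h.pos
  have hpi := Real.pi_pos
  have hA0 : 0 < A := by rw [hA]; positivity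
  have h2k : (1 : ℝ) ≤ 2 ^ k := one_le_pow₀ (by norm_num)
  refine (h.measure_levelSet (κ := Fin m) (ι := Fin (m + 1)) (R := 2 ^ k * R) hγ hμ
    (by positivity) (by nlinarith)).trans ?_
  have e1 : Real.pi * (28 * K ^ 2) * (76 * K * μ / (2 ^ k * R)) / γ = A * (μ / (2 ^ k * R)) := by
    rw [hA]; field_simp
  rw [e1, add_assoc]
  set n := Fintype.card (Fin (m + 1)) with hn
  have hnm : n = m + 1 := by simp [hn]
  have hm : Fintype.card (Fin m) = m := by simp
  have hnR : (n : ℝ) = m + 1 := by rw [hnm]; push_cast; ring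
  rw [hm]
  set B := A * (μ / (2 ^ k * R)) with hB
  have hB0 : 0 < B := by positivity
  calc (Real.exp 1 * (1 + 6 * (2 ^ k * R))) ^ n * (Real.exp (n / 2) * (B + _) ^ m)
      ≤ (Real.exp 1 * (2 ^ k * (1 + 6 * R))) ^ n * (Real.exp (n / 2) * (B + B) ^ m) := by
        gcongr
        nlinarith
    _ = Real.exp (3 / 2) * (2 ^ k * (1 + 6 * R)) *
          (Real.exp (-(5 / 2)) * (Real.exp 4 * (1 + 6 * R) * (2 * A * μ / R))) ^ m := by
        rw [hnR, hnm, pow_succ]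
        have e2 : Real.exp (((m : ℝ) + 1) / 2) = Real.exp (1 / 2) ^ m * Real.exp (1 / 2) := by
          rw [← pow_succ, ← Real.exp_nat_mul]; congr 1; push_cast; ring
        have e3 : Real.exp (3 / 2) = Real.exp 1 * Real.exp (1 / 2) := by
          rw [← Real.exp_add]; norm_num
        have e4 : Real.exp (-(5 / 2)) * (Real.exp 4 * (1 + 6 * R) * (2 * A * μ / R))
            = (Real.exp 1 * (2 ^ k * (1 + 6 * R))) * Real.exp (1 / 2) * (B + B) := by
          have e5 : Real.exp (-(5 / 2)) * Real.exp 4 = Real.exp 1 * Real.exp (1 / 2) := by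
            rw [← Real.exp_add, ← Real.exp_add]; norm_num
          have e6 : (2 ^ k : ℝ) * (B + B) = 2 * A * μ / R := by rw [hB]; field_simp; ring
          calc _ = (Real.exp (-(5 / 2)) * Real.exp 4) * (1 + 6 * R) * (2 * A * μ / R) := by ring
            _ = _ := by rw [e5, ← e6]; ring
        rw [e2, e3, e4, mul_pow (_ * Real.exp (1 / 2)), mul_pow _ (Real.exp (1 / 2))]
        ring
    _ ≤ Real.exp (3 / 2) * (2 ^ k * (1 + 6 * R)) * (Real.exp (-(5 / 2)) * 1) ^ m := by gcongr
    _ = Real.exp 4 * (1 + 6 * R) * 2 ^ k * Real.exp (-(5 / 2) * (m + 1)) := by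
        have e7 : Real.exp 4 * Real.exp (-(5 / 2) * (m + 1))
            = Real.exp (3 / 2) * Real.exp (-(5 / 2)) ^ m := by
          rw [← Real.exp_nat_mul, ← Real.exp_add, ← Real.exp_add]; congr 1; ring
        rw [mul_one]
        calc _ = (Real.exp (3 / 2) * Real.exp (-(5 / 2)) ^ m) * (1 + 6 * R) * 2 ^ k := by ring
          _ = _ := by rw [← e7]; ring

/-- With exponentially high probability, every unit vector orthogonal to the rows of a random
`m × (m + 1)` matrix has an exponentially large least common denominator. -/
theorem exists_kernel_farFromLattice {K : ℝ} (hK : 0 < K) :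
    ∃ γ μ R q C c : ℝ, ∃ N : ℕ, 0 < γ ∧ 0 < μ ∧ 0 < R ∧ 0 < q ∧ 0 < C ∧ 0 < c ∧
      ∀ ν : Measure ℝ, IsProbabilityMeasure ν → SubgaussianLaw K ν → ∀ m : ℕ, N ≤ m →
        (matrixLaw (Fin m) (Fin (m + 1)) ν).real
          {W | ∃ x : EuclideanSpace ℝ (Fin (m + 1)), ‖x‖ = 1 ∧ rowMap W x = 0 ∧
            ¬ FarFromLattice γ (μ * √(Fintype.card (Fin (m + 1))))
              (2 ^ ⌊q * (m + 1)⌋₊ * R * √(Fintype.card (Fin (m + 1)))) x}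
          ≤ C * Real.exp (-c * (m + 1)) := by
  have hpi := Real.pi_pos
  set l := 1 / (6144 * K ^ 4) with hl
  have hl0 : 0 < l := by positivity
  set γ := min (1 / 2) (1 / (304 * K)) with hγ
  have hγ0 : 0 < γ := lt_min (by norm_num) (by positivity)
  set R := l ^ 2 / 8192 with hR
  have hR0 : 0 < R := by positivity
  set A := Real.pi * (28 * K ^ 2) * (76 * K) / γ with hA
  have hA0 : 0 < A := by positivity
  -- the lattice net at a level has `O(2 ^ k) ^ n` points, each annihilated with probability
  -- `O(μ / 2 ^ k) ^ (n - 1)`; a small `μ` beats all the constants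
  set μ := min R (R / (Real.exp 4 * (1 + 6 * R) * (2 * A))) with hμ
  have hμ0 : 0 < μ := lt_min hR0 (by positivity)
  have hμA : Real.exp 4 * (1 + 6 * R) * (2 * A * μ / R) ≤ 1 := by
    have h1 : μ ≤ R / (Real.exp 4 * (1 + 6 * R) * (2 * A)) := min_le_right _ _
    rw [le_div_iff₀ (by positivity)] at h1
    rw [← mul_div_assoc, div_le_one hR0]
    linarith
  set d := min (2 / (28 * K ^ 2) ^ 2) ((Real.pi * (76 * K) / (28 * K ^ 2)) ^ 2) with hd
  have hd0 : 0 < d := lt_min (by positivity) (by positivity)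
  set q := min (1 / 2) (d * μ ^ 2 / 2) with hq
  have hq0 : 0 < q := lt_min (by norm_num) (by positivity)
  obtain ⟨N, hN⟩ : ∃ N : ℕ, ∀ m : ℕ, N ≤ m → 3 * R ≤ A * μ * Real.exp (d * μ ^ 2 / 2 * (m + 1)) := by
    have h1 : Filter.Tendsto (fun m : ℕ => A * μ * Real.exp (d * μ ^ 2 / 2 * (m + 1)))
        Filter.atTop Filter.atTop := by
      refine Filter.Tendsto.const_mul_atTop (by positivity) (Real.tendsto_exp_atTop.comp ?_)
      refine Filter.Tendsto.const_mul_atTop (by positivity) ?_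
      exact Filter.tendsto_atTop_add_const_right _ _ tendsto_natCast_atTop_atTop
    obtain ⟨N, hN⟩ := Filter.eventually_atTop.1 (h1.eventually_ge_atTop (3 * R))
    exact ⟨N, hN⟩
  refine ⟨γ, μ, R, q, 2 + Real.exp 4 * (1 + 6 * R), min 1 (l / 16), max N 1, hγ0, hμ0, hR0, hq0,
    by positivity, lt_min one_pos (by positivity), ?_⟩
  intro ν _ h m hm
  have hmN : N ≤ m := (le_max_left _ _).trans hm
  have hm1 : 1 ≤ m := (le_max_right _ _).trans hm
  set n := Fintype.card (Fin (m + 1)) with hn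
  have hnR : (n : ℝ) = m + 1 := by simp [hn]
  set L := ⌊q * (m + 1)⌋₊ with hL
  set α := μ * √(n : ℝ) with hα
  have h2L : (2 : ℝ) ^ L ≤ Real.exp (q * (m + 1)) := by
    have h1 : (2 : ℝ) ≤ Real.exp 1 := by have := Real.add_one_le_exp (1 : ℝ); linarith
    calc (2 : ℝ) ^ L ≤ Real.exp 1 ^ L := by gcongr
      _ = Real.exp L := by rw [← Real.exp_nat_mul, mul_one]
      _ ≤ _ := Real.exp_le_exp.2 (Nat.floor_le (by positivity))
  set P := matrixLaw (Fin m) (Fin (m + 1)) ν with hP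
  set S1 : Set (Fin m → Fin (m + 1) → ℝ) := {W | 38 * K * √n < ‖rowMap W‖} with hS1
  set S2 : Set (Fin m → Fin (m + 1) → ℝ) := {W | ∃ p ∈ latticeBall (Fin (m + 1)) (2 * R * √n),
        intVec p ≠ 0 ∧ ‖rowMap W (intVec p)‖ ≤ √n / 4 * ‖intVec p‖} with hS2
  have hsub : {W | ∃ x : EuclideanSpace ℝ (Fin (m + 1)), ‖x‖ = 1 ∧ rowMap W x = 0 ∧
      ¬ FarFromLattice γ α (2 ^ L * R * √n) x} ⊆ (S1 ∪ S2) ∪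
        ⋃ k ∈ Finset.range L, levelSet (Fin m) (Fin (m + 1)) K γ α (2 ^ k * R * √n) := by
    rintro W ⟨x, hx, hWx, hfar⟩
    by_contra hcon
    simp only [Set.mem_union, not_or, Set.mem_iUnion, not_exists] at hcon
    obtain ⟨⟨hc1, hc2⟩, hc3⟩ := hcon
    have hWn : ‖rowMap W‖ ≤ 38 * K * √n := not_lt.1 hc1
    refine hfar (farFromLattice_of_levels hWn hx hWx ?_ L fun k hk =>
      hc3 k (Finset.mem_range.2 hk))
    by_contra hnot
    exact hc2 (exists_short_lattice_of_not_far hK hWn hx hWx hγ0 (min_le_left _ _)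
      (min_le_right _ _) hnot)
  have b1 : P.real S1 ≤ Real.exp (-(m + 1)) := by
    rw [← hnR]
    exact h.opNorm_tail (by simp)
  have b2 : P.real S2 ≤ Real.exp (-(l / 16) * (m + 1)) := by
    rw [← hnR]
    exact h.short_lattice (by simp; omega) hl
  have b3 : ∀ k ∈ Finset.range L,
      P.real (levelSet (Fin m) (Fin (m + 1)) K γ α (2 ^ k * R * √n)) ≤
        Real.exp 4 * (1 + 6 * R) * 2 ^ k * Real.exp (-(5 / 2) * (m + 1)) := by
    intro k hk
    refine h.measure_levelSet_dyadic hγ0 hμ0 hR0 (min_le_left _ _) hA hμA ?_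
    have hsq : √(n : ℝ) ^ 2 = m + 1 := by rw [Real.sq_sqrt (by positivity), hnR]
    have t1 : Real.exp (-2 * (μ * √n / (28 * K ^ 2)) ^ 2) ≤ Real.exp (-(d * μ ^ 2 * (m + 1))) := by
      apply Real.exp_le_exp.2
      have e : -2 * (μ * √n / (28 * K ^ 2)) ^ 2 = -(2 / (28 * K ^ 2) ^ 2 * μ ^ 2 * (m + 1)) := by
        rw [← hsq]; ring
      rw [e, neg_le_neg_iff]
      gcongr
      exact min_le_left _ _
    have t2 : Real.exp (-(Real.pi * (76 * K * μ * √n) / (28 * K ^ 2)) ^ 2)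
        ≤ Real.exp (-(d * μ ^ 2 * (m + 1))) := by
      apply Real.exp_le_exp.2
      have e : -(Real.pi * (76 * K * μ * √n) / (28 * K ^ 2)) ^ 2
          = -((Real.pi * (76 * K) / (28 * K ^ 2)) ^ 2 * μ ^ 2 * (m + 1)) := by
        rw [← hsq]; ring
      rw [e, neg_le_neg_iff]
      gcongr
      exact min_le_right _ _
    have t3 : 3 * Real.exp (-(d * μ ^ 2 * (m + 1))) ≤ A * (μ / (2 ^ k * R)) := by
      rw [← mul_div_assoc, le_div_iff₀ (by positivity)]
      have hk2 : (2 : ℝ) ^ k ≤ Real.exp (d * μ ^ 2 / 2 * (m + 1)) := by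
        calc (2 : ℝ) ^ k ≤ 2 ^ L :=
              pow_le_pow_right₀ (by norm_num) (Finset.mem_range.1 hk).le
          _ ≤ Real.exp (q * (m + 1)) := h2L
          _ ≤ _ := by
              apply Real.exp_le_exp.2
              gcongr
              exact min_le_right _ _
      have hNm := hN m hmN
      calc 3 * Real.exp (-(d * μ ^ 2 * (m + 1))) * (2 ^ k * R)
          = 3 * R * 2 ^ k * Real.exp (-(d * μ ^ 2 * (m + 1))) := by ring
        _ ≤ A * μ * Real.exp (d * μ ^ 2 / 2 * (m + 1)) * Real.exp (d * μ ^ 2 / 2 * (m + 1))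
              * Real.exp (-(d * μ ^ 2 * (m + 1))) := by gcongr
        _ = A * μ := by
            rw [mul_assoc, mul_assoc, ← Real.exp_add, ← Real.exp_add]
            have : d * μ ^ 2 / 2 * (m + 1) + (d * μ ^ 2 / 2 * (m + 1) + -(d * μ ^ 2 * (m + 1)))
                = (0 : ℝ) := by ring
            rw [this, Real.exp_zero, mul_one]
    linarith
  have hsum : ∑ k ∈ Finset.range L, (2 : ℝ) ^ k ≤ 2 ^ L := by
    have := geom_sum_eq (show (2 : ℝ) ≠ 1 by norm_num) L
    rw [this]; linarith
  have b4 : P.real (⋃ k ∈ Finset.range L,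
      levelSet (Fin m) (Fin (m + 1)) K γ α (2 ^ k * R * √n)) ≤
        Real.exp 4 * (1 + 6 * R) * Real.exp (-(m + 1)) := by
    refine (measureReal_biUnion_finset_le _ _).trans ((Finset.sum_le_sum b3).trans ?_)
    rw [← Finset.sum_mul, ← Finset.mul_sum, mul_assoc]
    gcongr
    calc (∑ k ∈ Finset.range L, (2 : ℝ) ^ k) * Real.exp (-(5 / 2) * (m + 1))
        ≤ Real.exp (q * (m + 1)) * Real.exp (-(5 / 2) * (m + 1)) := by
          gcongr; exact hsum.trans h2L
      _ ≤ Real.exp (1 / 2 * (m + 1)) * Real.exp (-(5 / 2) * (m + 1)) := by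
          gcongr; exact min_le_left _ _
      _ ≤ _ := by
          rw [← Real.exp_add]
          apply Real.exp_le_exp.2
          have : (0 : ℝ) ≤ m := by positivity
          linarith
  have c1 : Real.exp (-((m : ℝ) + 1)) ≤ Real.exp (-(min 1 (l / 16)) * (m + 1)) := by
    apply Real.exp_le_exp.2
    rw [neg_mul, neg_le_neg_iff]
    exact mul_le_of_le_one_left (by positivity) (min_le_left _ _)
  have c2 : Real.exp (-(l / 16) * ((m : ℝ) + 1)) ≤ Real.exp (-(min 1 (l / 16)) * (m + 1)) := by
    apply Real.exp_le_exp.2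
    rw [neg_mul, neg_mul, neg_le_neg_iff]
    gcongr
    exact min_le_right _ _
  have c3 : Real.exp 4 * (1 + 6 * R) * Real.exp (-((m : ℝ) + 1)) ≤
      Real.exp 4 * (1 + 6 * R) * Real.exp (-(min 1 (l / 16)) * (m + 1)) := by gcongr
  calc _ ≤ P.real ((S1 ∪ S2) ∪ ⋃ k ∈ Finset.range L,
          levelSet (Fin m) (Fin (m + 1)) K γ α (2 ^ k * R * √n)) :=
        measureReal_mono hsub (measure_ne_top _ _)
    _ ≤ (P.real S1 + P.real S2) + P.real (⋃ k ∈ Finset.range L,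
          levelSet (Fin m) (Fin (m + 1)) K γ α (2 ^ k * R * √n)) :=
        (measureReal_union_le _ _).trans (add_le_add_left (measureReal_union_le _ _) _)
    _ ≤ _ := by linarith

/-! ### The distance from a row to the span of the others -/

/-- The distance from the vector `z.1` to the span of the rows `z.2 i`. -/
noncomputable def rowDist {κ ι : Type*} [Fintype ι] (z : (ι → ℝ) × (κ → ι → ℝ)) : ℝ :=
  Metric.infDist (WithLp.toLp 2 z.1 : EuclideanSpace ℝ ι)
    (Submodule.span ℝ (Set.range fun i => (WithLp.toLp 2 (z.2 i) : EuclideanSpace ℝ ι)))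

section

variable {κ ι : Type*} [Fintype κ] [Fintype ι]

/-- The distance is upper semicontinuous, as an infimum over the coefficients of the linear
combinations, hence measurable. -/
theorem measurable_rowDist : Measurable (rowDist (κ := κ) (ι := ι)) := by
  refine measurable_of_Iio fun r => IsOpen.measurableSet ?_
  have e : rowDist (κ := κ) (ι := ι) ⁻¹' Set.Iio r = ⋃ c : κ → ℝ,
      {z | dist (WithLp.toLp 2 z.1 : EuclideanSpace ℝ ι)
        (∑ i, c i • (WithLp.toLp 2 (z.2 i) : EuclideanSpace ℝ ι)) < r} := by
    ext z
    simp only [Set.mem_preimage, Set.mem_Iio, rowDist, Set.mem_iUnion, Set.mem_ofPred_eq]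
    rw [Metric.infDist_lt_iff ⟨0, Submodule.zero_mem _⟩]
    simp only [SetLike.mem_coe, Submodule.mem_span_range_iff_exists_fun]
    constructor
    · rintro ⟨y, ⟨c, rfl⟩, h⟩
      exact ⟨c, h⟩
    · rintro ⟨c, h⟩
      exact ⟨_, ⟨c, rfl⟩, h⟩
  rw [e]
  refine isOpen_iUnion fun c => isOpen_lt (Continuous.dist ?_ ?_) continuous_const
  · exact (PiLp.continuous_toLp 2 _).comp continuous_fst
  · refine continuous_finsetSum _ fun i _ => ?_
    have hc : Continuous fun z : (ι → ℝ) × (κ → ι → ℝ) =>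
        (WithLp.toLp 2 (z.2 i) : EuclideanSpace ℝ ι) :=
      (PiLp.continuous_toLp 2 _).comp ((continuous_apply i).comp continuous_snd)
    exact hc.const_smul (c i)

/-- The distance to the span is at least the length of the projection onto a unit normal. -/
theorem abs_dotProduct_le_rowDist {W : κ → ι → ℝ} {x : EuclideanSpace ℝ ι} (hx : ‖x‖ = 1)
    (hWx : rowMap W x = 0) (y : ι → ℝ) : |y ⬝ᵥ x| ≤ rowDist (y, W) := by
  set H := Submodule.span ℝ (Set.range fun i => (WithLp.toLp 2 (W i) : EuclideanSpace ℝ ι)) with hH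
  have hdot : ∀ z : EuclideanSpace ℝ ι, inner ℝ x z = z ⬝ᵥ x := fun z => by
    simp [PiLp.inner_apply, dotProduct]
  have horth : ∀ z ∈ H, inner ℝ x z = 0 := by
    intro z hz
    induction hz using Submodule.span_induction with
    | mem z hz =>
      obtain ⟨i, rfl⟩ := hz
      rw [hdot]
      change W i ⬝ᵥ x = 0
      rw [← rowMap_apply, hWx]; rfl
    | zero => simp
    | add a b _ _ ha hb => rw [inner_add_right, ha, hb, add_zero]
    | smul a b _ hb => rw [inner_smul_right, hb, mul_zero]
  unfold rowDist
  refine (Metric.le_infDist ⟨0, Submodule.zero_mem _⟩).2 fun z hz => ?_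
  have h1 : y ⬝ᵥ x = inner ℝ x (WithLp.toLp 2 y - z) := by
    rw [inner_sub_right, horth z hz, sub_zero, hdot]
  rw [h1, dist_eq_norm]
  exact (abs_real_inner_le_norm _ _).trans (by rw [hx, one_mul])

end

theorem exists_unit_kernel {m : ℕ} (W : Fin m → Fin (m + 1) → ℝ) :
    ∃ x : EuclideanSpace ℝ (Fin (m + 1)), ‖x‖ = 1 ∧ rowMap W x = 0 := by
  have h : LinearMap.ker (rowMap W : EuclideanSpace ℝ (Fin (m + 1)) →ₗ[ℝ]
      EuclideanSpace ℝ (Fin m)) ≠ ⊥ :=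
    LinearMap.ker_ne_bot_of_finrank_lt (by simp)
  obtain ⟨v, hv, hv0⟩ := Submodule.exists_mem_ne_zero_of_ne_bot h
  have hv' : 0 < ‖v‖ := norm_pos_iff.2 hv0
  refine ⟨‖v‖⁻¹ • v, by rw [norm_smul, norm_inv, norm_norm, inv_mul_cancel₀ hv'.ne'], ?_⟩
  have : rowMap W v = 0 := hv
  rw [map_smul, this, smul_zero]

/-- Fubini bound: sections are small outside an exceptional, possibly nonmeasurable, set. -/
theorem measureReal_prod_le_of_sections {α β : Type*} [MeasurableSpace α] [MeasurableSpace β]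
    (P : Measure α) (M : Measure β) [IsProbabilityMeasure P] [IsProbabilityMeasure M]
    {s : Set (α × β)} (hs : MeasurableSet s) {bad : Set β} {B : ℝ} (hB : 0 ≤ B)
    (h : ∀ y ∉ bad, P.real {x | (x, y) ∈ s} ≤ B) :
    (P.prod M).real s ≤ M.real bad + B := by
  set T := toMeasurable M bad with hT
  have h1 : (P.prod M) s ≤ M bad + ENNReal.ofReal B := by
    rw [Measure.prod_apply_symm hs]
    calc ∫⁻ y, P ((fun x => (x, y)) ⁻¹' s) ∂M
        ≤ ∫⁻ y, (T.indicator 1 y + ENNReal.ofReal B) ∂M := by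
          refine lintegral_mono fun y => ?_
          by_cases hy : y ∈ bad
          · have : y ∈ T := subset_toMeasurable M bad hy
            rw [Set.indicator_of_mem this]
            exact le_add_right prob_le_one
          · refine le_add_left ?_
            change P {x | (x, y) ∈ s} ≤ _
            rw [← ofReal_measureReal]
            exact ENNReal.ofReal_le_ofReal (h y hy)
      _ = M bad + ENNReal.ofReal B := by
          rw [lintegral_add_right _ measurable_const,
            lintegral_indicator_one (measurableSet_toMeasurable _ _), measure_toMeasurable]
          simp
  have h2 := ENNReal.toReal_mono (by finiteness) h1
  rwa [ENNReal.toReal_add (measure_ne_top _ _) ENNReal.ofReal_ne_top,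
    ENNReal.toReal_ofReal hB] at h2

section

variable {ι : Type*} [Fintype ι] {K : ℝ} {ν : Measure ℝ} [IsProbabilityMeasure ν]

theorem exp_half_le_two : Real.exp (1 / 2) ≤ 2 := by
  refine le_of_pow_le_pow_left₀ two_ne_zero (by norm_num) ?_
  rw [← Real.exp_nat_mul]
  have := Real.exp_one_lt_d9
  norm_num
  linarith

/-- Markov's inequality for the Laplace transform of the squared linear form. -/
theorem measureReal_abs_dotProduct_le (x : ι → ℝ) {l : ℝ} (hl : 0 ≤ l) {t : ℝ} :
    (Measure.pi fun _ : ι => ν).real {y | |y ⬝ᵥ x| ≤ t} ≤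
      Real.exp (l * t ^ 2) * ∫ y, Real.exp (-l * (y ⬝ᵥ x) ^ 2) ∂(Measure.pi fun _ : ι => ν) := by
  have hi : Integrable (fun y : ι → ℝ => Real.exp (-l * (y ⬝ᵥ x) ^ 2))
      (Measure.pi fun _ : ι => ν) := by
    have hm := measurable_dotProduct_right (ι := ι) x
    refine (integrable_const (1 : ℝ)).mono' (by fun_prop) (Filter.Eventually.of_forall fun y => ?_)
    rw [Real.norm_of_nonneg (by positivity)]
    exact Real.exp_le_one_iff.2 (by nlinarith [sq_nonneg (y ⬝ᵥ x)])
  have h := mul_meas_ge_le_integral_of_nonneg (μ := Measure.pi fun _ : ι => ν)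
    (f := fun y => Real.exp (-l * (y ⬝ᵥ x) ^ 2))
    (Filter.Eventually.of_forall fun y => (Real.exp_pos _).le) hi (Real.exp (-(l * t ^ 2)))
  rw [Real.exp_neg, inv_mul_le_iff₀ (Real.exp_pos _)] at h
  refine (measureReal_mono ?_ (measure_ne_top _ _)).trans h
  intro y hy
  have hy : |y ⬝ᵥ x| ≤ t := hy
  change (Real.exp (l * t ^ 2))⁻¹ ≤ Real.exp (-l * (y ⬝ᵥ x) ^ 2)
  rw [← Real.exp_neg]
  apply Real.exp_le_exp.2
  have : |y ⬝ᵥ x| ^ 2 ≤ t ^ 2 := by gcongr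
  rw [sq_abs] at this
  nlinarith

theorem SubgaussianLaw.crude_abs (h : SubgaussianLaw K ν) {l : ℝ} (hl : l = 1 / (6144 * K ^ 4))
    {x : EuclideanSpace ℝ ι} (hx : ‖x‖ = 1) :
    (Measure.pi fun _ : ι => ν).real {y | |y ⬝ᵥ x| ≤ 1 / 2} ≤ Real.exp (-(l / 4)) := by
  have hK := h.pos
  have hl0 : 0 < l := by rw [hl]; positivity
  have hx1 : ∑ j, x j ^ 2 = 1 := by rw [← EuclideanSpace.real_norm_sq_eq, hx, one_pow]
  refine (measureReal_abs_dotProduct_le x hl0.le).trans ?_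
  calc _ ≤ Real.exp (l * (1 / 2) ^ 2) * Real.exp (-(l / 2)) := by
        gcongr
        refine (h.crude_laplace hx1 hl).trans ?_
        have := Real.add_one_le_exp (-(l / 2))
        linarith
    _ = _ := by rw [← Real.exp_add]; congr 1; ring

theorem SubgaussianLaw.small_ball_abs (h : SubgaussianLaw K ν) {γ α D t : ℝ} (hγ : 0 < γ)
    (ht : 0 < t) (hD : 0 ≤ D) {x : ι → ℝ} (hx : FarFromLattice γ α D x) :
    (Measure.pi fun _ : ι => ν).real {y | |y ⬝ᵥ x| ≤ t} ≤
      2 * (Real.pi * (28 * K ^ 2) * t / γ + Real.exp (-2 * (α / (28 * K ^ 2)) ^ 2)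
        + 2 * Real.exp (-(Real.pi * t * D / (28 * K ^ 2)) ^ 2)) := by
  have hsb := h.small_ball hγ ht hD hx
  have e : ∀ z : ι → ℝ, -(z ⬝ᵥ x) ^ 2 / (2 * t ^ 2) = -(1 / (2 * t ^ 2)) * (z ⬝ᵥ x) ^ 2 :=
    fun z => by ring
  simp only [e] at hsb
  refine (measureReal_abs_dotProduct_le x (l := 1 / (2 * t ^ 2)) (by positivity)).trans ?_
  have e2 : 1 / (2 * t ^ 2) * t ^ 2 = 1 / 2 := by field_simp
  rw [e2]
  have h0 : 0 ≤ ∫ y, Real.exp (-(1 / (2 * t ^ 2)) * (y ⬝ᵥ x) ^ 2) ∂(Measure.pi fun _ : ι => ν) :=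
    integral_nonneg fun y => (Real.exp_pos _).le
  exact mul_le_mul exp_half_le_two hsb h0 (by norm_num)

end

/-- In every dimension the distance exceeds `1 / 2` with probability bounded below; for larger `ε`
the term `2 * ε` exceeds `1`. -/
theorem SubgaussianLaw.rowDist_crude {K : ℝ} {ν : Measure ℝ} [IsProbabilityMeasure ν]
    (h : SubgaussianLaw K ν) {l : ℝ} (hl : l = 1 / (6144 * K ^ 4)) (m : ℕ) {ε : ℝ}
    (hε : 0 ≤ ε) :
    ((Measure.pi fun _ : Fin (m + 1) => ν).prod (matrixLaw (Fin m) (Fin (m + 1)) ν)).real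
      {z | rowDist z ≤ ε} ≤ 2 * ε + Real.exp (-(l / 4)) := by
  rcases le_or_gt ε (1 / 2) with hε2 | hε2
  · have := measureReal_prod_le_of_sections (Measure.pi fun _ : Fin (m + 1) => ν)
      (matrixLaw (Fin m) (Fin (m + 1)) ν) (s := {z | rowDist z ≤ ε}) (bad := ∅)
      (measurableSet_le measurable_rowDist measurable_const) (Real.exp_pos (-(l / 4))).le ?_
    · simp only [measureReal_empty] at this
      linarith
    · intro W _
      obtain ⟨x, hx, hWx⟩ := exists_unit_kernel W
      refine (measureReal_mono ?_ (measure_ne_top _ _)).trans (h.crude_abs hl hx)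
      intro y hy
      have hy : rowDist (y, W) ≤ ε := hy
      exact (abs_dotProduct_le_rowDist hx hWx y).trans (hy.trans hε2)
  · refine measureReal_le_one.trans ?_
    have := Real.exp_pos (-(l / 4))
    linarith

theorem two_pow_floor_inv_le (a : ℝ) :
    ((2 : ℝ) ^ ⌊a⌋₊)⁻¹ ≤ 2 * Real.exp (-(a / 2)) := by
  have h1 : Real.exp ((⌊a⌋₊ : ℝ) / 2) ≤ 2 ^ ⌊a⌋₊ := by
    have : Real.exp ((⌊a⌋₊ : ℝ) / 2) = Real.exp (1 / 2) ^ ⌊a⌋₊ := by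
      rw [← Real.exp_nat_mul]; congr 1; ring
    rw [this]
    exact pow_le_pow_left₀ (Real.exp_pos _).le exp_half_le_two _
  calc ((2 : ℝ) ^ ⌊a⌋₊)⁻¹ ≤ (Real.exp ((⌊a⌋₊ : ℝ) / 2))⁻¹ := by gcongr
    _ = Real.exp (-((⌊a⌋₊ : ℝ) / 2)) := (Real.exp_neg _).symm
    _ ≤ Real.exp (1 / 2 + -(a / 2)) := by
        apply Real.exp_le_exp.2
        have := Nat.lt_floor_add_one a
        linarith
    _ ≤ _ := by
        rw [Real.exp_add]
        gcongr
        exact exp_half_le_two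

/-- In large dimension: the kernel of the first rows consists of vectors with exponentially large
least common denominator, for which the small ball estimate is almost scale-invariant. -/
theorem exists_rowDist_fine {K : ℝ} (hK : 0 < K) :
    ∃ C₁ C₂ c : ℝ, ∃ N : ℕ, 0 < C₁ ∧ 0 < C₂ ∧ 0 < c ∧
      ∀ ν : Measure ℝ, IsProbabilityMeasure ν → SubgaussianLaw K ν → ∀ m : ℕ, N ≤ m →
        ∀ ε : ℝ, 0 ≤ ε →
        ((Measure.pi fun _ : Fin (m + 1) => ν).prod (matrixLaw (Fin m) (Fin (m + 1)) ν)).real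
          {z | rowDist z ≤ ε} ≤ C₁ * ε + C₂ * Real.exp (-c * (m + 1)) := by
  have hpi := Real.pi_pos
  obtain ⟨γ, μ, R, q, C, c, N, hγ, hμ, hR, hq, hC, hc, H⟩ := exists_kernel_farFromLattice hK
  set b := 28 * K ^ 2 with hb
  have hb0 : 0 < b := by positivity
  set A := 2 * (Real.pi * b / γ) with hA
  have hA0 : 0 < A := by positivity
  set c' := min (min c (q / 2)) (min (2 * (μ / b) ^ 2) ((Real.pi * R / b) ^ 2)) with hc'
  have hc'0 : 0 < c' := lt_min (lt_min hc (by positivity)) (lt_min (by positivity) (by positivity))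
  refine ⟨A, C + 2 * A + 6, c', N, hA0, by positivity, hc'0, ?_⟩
  intro ν _ h m hm ε hε
  set n := Fintype.card (Fin (m + 1)) with hn
  have hnR : (n : ℝ) = m + 1 := by simp [hn]
  have hsq : √(n : ℝ) ^ 2 = m + 1 := by rw [Real.sq_sqrt (by positivity), hnR]
  set L := ⌊q * (m + 1)⌋₊ with hL
  -- the scale `t` exceeds `ε` by `1 / 2 ^ L`, the inverse of the denominator bound up to `R √n`
  set t := ε + ((2 : ℝ) ^ L)⁻¹ with ht
  have ht0 : 0 < t := by positivity
  have hmono : ∀ a, c' ≤ a → Real.exp (-(a * ((m : ℝ) + 1))) ≤ Real.exp (-c' * (m + 1)) := by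
    intro a ha
    apply Real.exp_le_exp.2
    rw [neg_mul, neg_le_neg_iff]
    gcongr
  set e := Real.exp (-c' * (m + 1)) with he
  have he0 : 0 < e := Real.exp_pos _
  have t1 : ((2 : ℝ) ^ L)⁻¹ ≤ 2 * e := by
    refine (two_pow_floor_inv_le _).trans ?_
    gcongr
    have := hmono (q / 2) ((min_le_left _ _).trans (min_le_right _ _))
    rwa [div_mul_eq_mul_div] at this
  have t2 : Real.exp (-2 * (μ * √n / b) ^ 2) ≤ e := by
    have e1 : -2 * (μ * √n / b) ^ 2 = -(2 * (μ / b) ^ 2 * (m + 1)) := by rw [← hsq]; ring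
    rw [e1]
    exact hmono _ ((min_le_right _ _).trans (min_le_left _ _))
  have t3 : Real.exp (-(Real.pi * t * (2 ^ L * R * √n) / b) ^ 2) ≤ e := by
    refine le_trans ?_ (hmono ((Real.pi * R / b) ^ 2) ((min_le_right _ _).trans (min_le_right _ _)))
    apply Real.exp_le_exp.2
    rw [neg_le_neg_iff, ← hsq, ← mul_pow]
    have h1 : 1 ≤ t * 2 ^ L := by
      rw [ht, add_mul, inv_mul_cancel₀ (by positivity)]
      have : 0 ≤ ε * 2 ^ L := by positivity
      linarith
    have h2 : Real.pi * t * (2 ^ L * R * √n) / b = Real.pi * R / b * √n * (t * 2 ^ L) := by ring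
    have e3 : Real.pi * R / b * √n ≤ Real.pi * R / b * √n * (t * 2 ^ L) :=
      le_mul_of_one_le_right (by positivity) h1
    rw [h2]
    exact pow_le_pow_left₀ (by positivity) e3 2
  -- sections over a matrix all of whose unit kernel vectors are far from the lattice are small
  have key := measureReal_prod_le_of_sections (Measure.pi fun _ : Fin (m + 1) => ν)
    (matrixLaw (Fin m) (Fin (m + 1)) ν) (s := {z | rowDist z ≤ ε})
    (measurableSet_le measurable_rowDist measurable_const)
    (B := A * ε + (2 * A + 6) * e) (by positivity) (bad := {W | ∃ x : EuclideanSpace ℝ (Fin (m + 1)),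
      ‖x‖ = 1 ∧ rowMap W x = 0 ∧ ¬ FarFromLattice γ (μ * √n) (2 ^ L * R * √n) x}) ?_
  · refine key.trans ?_
    have hbad := H ν inferInstance h m hm
    have h1 : Real.exp (-c * ((m : ℝ) + 1)) ≤ e := by
      rw [neg_mul]
      exact hmono c ((min_le_left _ _).trans (min_le_left _ _))
    have h2 := mul_le_mul_of_nonneg_left h1 hC.le
    linarith
  · intro W hW
    obtain ⟨x, hx, hWx⟩ := exists_unit_kernel W
    have hfar : FarFromLattice γ (μ * √n) (2 ^ L * R * √n) x := by
      by_contra hcon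
      exact hW ⟨x, hx, hWx, hcon⟩
    refine (measureReal_mono ?_ (measure_ne_top _ _)).trans
      ((h.small_ball_abs hγ ht0 (by positivity) hfar).trans ?_)
    · intro y hy
      have hy : rowDist (y, W) ≤ ε := hy
      have : 0 ≤ ((2 : ℝ) ^ L)⁻¹ := by positivity
      exact (abs_dotProduct_le_rowDist hx hWx y).trans (by linarith)
    · have e1 : 2 * (Real.pi * b * t / γ) = A * t := by rw [hA]; ring
      have e2 : A * t ≤ A * ε + A * (2 * e) := by
        rw [ht, mul_add]; gcongr
      linarith

/-! ### From random vectors to the law of the matrix -/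

/-- Currying the product law of the entries gives independent rows; the last one is split off. -/
theorem map_rows_eq_prod {Ω : Type*} [MeasurableSpace Ω] {μ : Measure Ω} [IsProbabilityMeasure μ]
    {m : ℕ} {X : Fin (m + 1) → Ω → EuclideanSpace ℝ (Fin (m + 1))}
    (hX : ∀ i j, Measurable fun ω => X i ω j)
    (hind : iIndepFun (fun (p : Fin (m + 1) × Fin (m + 1)) (ω : Ω) => X p.1 ω p.2) μ)
    {ν : Measure ℝ} [IsProbabilityMeasure ν] (hν : ∀ i j, μ.map (fun ω => X i ω j) = ν) :
    μ.map (fun ω => ((fun j => X (Fin.last m) ω j), fun (i : Fin m) j => X i.castSucc ω j))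
      = (Measure.pi fun _ : Fin (m + 1) => ν).prod (matrixLaw (Fin m) (Fin (m + 1)) ν) := by
  have h1 : μ.map (fun ω (p : Fin (m + 1) × Fin (m + 1)) => X p.1 ω p.2)
      = Measure.pi fun _ => ν := by
    rw [iIndepFun.map_fun_eq_pi_map
      (f := fun (p : Fin (m + 1) × Fin (m + 1)) (ω : Ω) => X p.1 ω p.2)
      (fun p => (hX p.1 p.2).aemeasurable) hind]
    simp only [hν]
  have h2 : μ.map (fun ω i j => X i ω j) = matrixLaw (Fin (m + 1)) (Fin (m + 1)) ν := by
    have hcur := Measure.infinitePi_map_curry (ι := Fin (m + 1)) (κ := Fin (m + 1))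
      (fun _ _ => ν)
    simp only [Measure.infinitePi_eq_pi] at hcur
    have hm : Measurable fun ω (p : Fin (m + 1) × Fin (m + 1)) => X p.1 ω p.2 :=
      measurable_pi_lambda _ fun p => hX p.1 p.2
    rw [← h1, Measure.map_map (MeasurableEquiv.measurable _) hm] at hcur
    exact hcur
  have h3 := measurePreserving_piFinSuccAbove
    (fun _ : Fin (m + 1) => Measure.pi fun _ : Fin (m + 1) => ν) (Fin.last m)
  have h4 := h3.map_eq
  have hm : Measurable fun ω (i j : Fin (m + 1)) => X i ω j :=
    measurable_pi_lambda _ fun i => measurable_pi_lambda _ fun j => hX i j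
  unfold matrixLaw at h2
  rw [← h2, Measure.map_map (MeasurableEquiv.measurable _) hm] at h4
  rw [← h4]
  congr 1
  ext ω : 1
  refine Prod.ext rfl ?_
  ext i j
  simp [MeasurableEquiv.piFinSuccAbove, Fin.insertNthEquiv]
  rfl

theorem infDist_spanInit_eq_rowDist {m : ℕ} (x : Fin (m + 1) → EuclideanSpace ℝ (Fin (m + 1))) :
    Metric.infDist (x (Fin.last m)) (spanInit x : Set (EuclideanSpace ℝ (Fin (m + 1))))
      = rowDist ((fun j => x (Fin.last m) j), fun (i : Fin m) j => x i.castSucc j) := by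
  have : {v | ∃ i : Fin (m + 1), (i : ℕ) + 1 < m + 1 ∧ x i = v}
      = Set.range fun i : Fin m => x i.castSucc := by
    ext v
    constructor
    · rintro ⟨i, hi, rfl⟩
      exact ⟨⟨i, by omega⟩, rfl⟩
    · rintro ⟨i, rfl⟩
      exact ⟨i.castSucc, by simp, rfl⟩
  unfold rowDist spanInit
  rw [this]

theorem mainTheorem2 :
    ∀ K : ℝ, 0 < K → ∃ C c : ℝ, 0 < C ∧ 0 < c ∧ c < 1 ∧
      ∀ (Ω : Type*) (_ : MeasurableSpace Ω) (μ : Measure Ω) (_ : IsProbabilityMeasure μ)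
        (n : ℕ) (hn : 1 ≤ n) (X : Fin n → Ω → EuclideanSpace ℝ (Fin n)),
        (∀ i j, Measurable fun ω => X i ω j) →
        iIndepFun (fun (p : Fin n × Fin n) (ω : Ω) => X p.1 ω p.2) μ →
        (∀ i j i' j', IdentDistrib (fun ω => X i ω j) (fun ω => X i' ω j') μ μ) →
        (∀ i j, ∫ ω, X i ω j ∂μ = 0) →
        (∀ i j, variance (fun ω => X i ω j) μ = 1) →
        (∀ i j, HasSubgaussianMoment μ (fun ω => X i ω j) K) →
        ∀ ε : ℝ, 0 ≤ ε →
          μ.real {ω | Metric.infDist (X ⟨n - 1, Nat.sub_one_lt_of_lt hn⟩ ω)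
              (spanInit (fun i => X i ω) : Set (EuclideanSpace ℝ (Fin n))) ≤ ε}
            ≤ C * ε + c ^ n := by
  intro K hK
  obtain ⟨C₁, C₂, c, N, hC₁, hC₂, hc, hfine⟩ := exists_rowDist_fine hK
  set l := 1 / (6144 * K ^ 4) with hl
  have hl0 : 0 < l := by positivity
  obtain ⟨N', hN'⟩ : ∃ N' : ℕ, ∀ m : ℕ, N' ≤ m → C₂ ≤ Real.exp (c / 2 * (m + 1)) := by
    have h1 : Filter.Tendsto (fun m : ℕ => Real.exp (c / 2 * ((m : ℝ) + 1)))
        Filter.atTop Filter.atTop := by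
      refine Real.tendsto_exp_atTop.comp (Filter.Tendsto.const_mul_atTop (by positivity) ?_)
      exact Filter.tendsto_atTop_add_const_right _ _ tendsto_natCast_atTop_atTop
    exact Filter.eventually_atTop.1 (h1.eventually_ge_atTop C₂)
  set M := max N N' + 1 with hM
  have hM0 : (0 : ℝ) < M := by rw [hM]; positivity
  -- dimensions up to `M` are covered by the crude bound, larger ones by the fine bound
  refine ⟨C₁ + 2, max (Real.exp (-(c / 2))) (Real.exp (-(l / (4 * M)))), by positivity,
    lt_max_of_lt_left (Real.exp_pos _), max_lt ?_ ?_, ?_⟩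
  · exact Real.exp_lt_one_iff.2 (by linarith)
  · have : 0 < l / (4 * M) := by positivity
    exact Real.exp_lt_one_iff.2 (by linarith)
  intro Ω _ μ _ n hn X hX hind hid hmean hvar hsub ε hε
  obtain ⟨m, rfl⟩ : ∃ m, n = m + 1 := ⟨n - 1, by omega⟩
  set ν := μ.map (fun ω => X 0 ω 0) with hν
  have hνp : IsProbabilityMeasure ν := Measure.isProbabilityMeasure_map (hX 0 0).aemeasurable
  have hmap : ∀ i j, μ.map (fun ω => X i ω j) = ν := fun i j => (hid i j 0 0).map_eq
  have hlaw : SubgaussianLaw K ν := by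
    refine ⟨hK, ?_, ?_, ?_⟩
    · rw [hν, integral_map (hX 0 0).aemeasurable (by fun_prop)]
      exact hmean 0 0
    · rw [hν, integral_map (hX 0 0).aemeasurable (by fun_prop)]
      rw [← hvar 0 0, variance_of_integral_eq_zero (hX 0 0).aemeasurable (hmean 0 0)]
    · intro t ht
      rw [hν, map_measureReal_apply (hX 0 0) (measurableSet_lt measurable_const measurable_abs)]
      exact (hsub 0 0).2 t ht
  have hevent : μ.real {ω | Metric.infDist (X ⟨m + 1 - 1, Nat.sub_one_lt_of_lt hn⟩ ω)
        (spanInit (fun i => X i ω) : Set (EuclideanSpace ℝ (Fin (m + 1)))) ≤ ε} =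
      ((Measure.pi fun _ : Fin (m + 1) => ν).prod (matrixLaw (Fin m) (Fin (m + 1)) ν)).real
        {z | rowDist z ≤ ε} := by
    rw [← map_rows_eq_prod hX hind hmap, map_measureReal_apply]
    · congr 1
      ext ω
      change Metric.infDist (X (Fin.last m) ω) _ ≤ ε ↔ rowDist _ ≤ ε
      rw [infDist_spanInit_eq_rowDist fun i => X i ω]
    · exact (measurable_pi_lambda _ fun j => hX _ j).prodMk
        (measurable_pi_lambda _ fun i => measurable_pi_lambda _ fun j => hX _ j)
    · exact measurableSet_le measurable_rowDist measurable_const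
  rw [hevent]
  rcases le_or_gt M (m + 1) with hm | hm
  · have hmN : N ≤ m := (le_max_left N N').trans (by omega)
    have hmN' : N' ≤ m := (le_max_right N N').trans (by omega)
    refine (hfine ν hνp hlaw m hmN ε hε).trans ?_
    have h1 : C₂ * Real.exp (-c * (m + 1)) ≤ Real.exp (-(c / 2)) ^ (m + 1) := by
      calc C₂ * Real.exp (-c * (m + 1)) ≤ Real.exp (c / 2 * (m + 1)) * Real.exp (-c * (m + 1)) := by
            gcongr
            exact hN' m hmN'
        _ = _ := by
            rw [← Real.exp_add, ← Real.exp_nat_mul]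
            congr 1; push_cast; ring
    have h2 : Real.exp (-(c / 2)) ^ (m + 1) ≤
        max (Real.exp (-(c / 2))) (Real.exp (-(l / (4 * M)))) ^ (m + 1) :=
      pow_le_pow_left₀ (Real.exp_pos _).le (le_max_left _ _) _
    linarith
  · refine (hlaw.rowDist_crude hl m hε).trans ?_
    have h1 : Real.exp (-(l / 4)) ≤ Real.exp (-(l / (4 * M))) ^ (m + 1) := by
      rw [← Real.exp_nat_mul]
      apply Real.exp_le_exp.2
      have h3 : ((m + 1 : ℕ) : ℝ) ≤ M := by exact_mod_cast hm.le
      have h4 : ((m + 1 : ℕ) : ℝ) * (l / (4 * M)) ≤ M * (l / (4 * M)) := by gcongr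
      have h5 : (M : ℝ) * (l / (4 * M)) = l / 4 := by field_simp
      linarith
    have h2 : Real.exp (-(l / (4 * M))) ^ (m + 1) ≤
        max (Real.exp (-(c / 2))) (Real.exp (-(l / (4 * M)))) ^ (m + 1) :=
      pow_le_pow_left₀ (Real.exp_pos _).le (le_max_right _ _) _
    have h6 : 0 ≤ C₁ * ε := by positivity
    linarith
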